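/- All rings are associative with identity. A ring $\Lambda$ is called a *Noetherian algebra* if it is a module-finite algebra over some commutative Noetherian ring. For a Noetherian algebra $\Lambda$, let $\mathrm{mod}\,\Lambda$ be the abelian category of finitely generated right $\Lambda$-modules and $\mathbf{D}^b(\mathrm{mod}\,\Lambda)$ its bounded derived category. All dimensions below take values in $\{0,1,2,\dots\}\cup\{\infty\}$, and $\inf\emptyset=\infty$. For a class $\mathcal U$ of objects of an abelian category, $\mathrm{add}\,\mathcal U$ denotes the class of direct summands of finite direct sums of objects of $\mathcal U$. * *Igusa–Todorov distance.* $\mathrm{IT}(\Lambda)$ is the infimum of the integers $m\ge 0$ for which there are an integer $n\ge0$ and an object $U$ of $\mathrm{mod}\,\Lambda$ such that every $X$ in $\mathrm{mod}\,\Lambda$ admits an exact sequence $0\to U_m\to\cdots\to U_1\to U_0\to\Omega^n(X)\to0$ with all $U_i\in\mathrm{add}\,U$. Here $\Omega^n(X)$ denotes an $n$-th syzygy of $X$: $\Omega^0(X)=X$, and $\Omega^{n+1}(X)$ is the kernel of an epimorphism from a projective object of $\mathrm{mod}\,\Lambda$ onto $\Omega^{n}(X)$. * *Extension dimension.* For classes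 $\mathcal U,\mathcal V$ of objects let $\mathcal U\bullet\mathcal V$ be $\mathrm{add}$ of the class of all $X$ for which there is an exact sequence $0\to U\to X\to V\to0$ with $U\in\mathcal U$, $V\in\mathcal V$. Put $[T]_1=\mathrm{add}\,T$ and $[T]_{n+1}=[T]_1\bullet[T]_{n}$ for $n\ge1$. Then $\dim\Lambda$ is the infimum of the integers $n\ge0$ such that $\mathrm{mod}\,\Lambda=[T]_{n+1}$ for some object $T$. * *Rouquier dimension.* For an object $T$ of a triangulated category $\mathscr T$ let $\langle T\rangle_1$ be the class of direct summands of finite direct sums of shifts of $T$, and let $\langle T\rangle_{n+1}$ be the class of direct summands of objects $X$ lying in a distinguished triangle $U\to X\to V\to U[1]$ with $U\in\langle T\rangle_1$ and $V\in\langle T\rangle_n$. Then $\mathrm{der.dim}\,\mathscr T$ is the infimum of the integers $n\ge0$ such that $\mathscr T=\langle T\rangle_{n+1}$ for some object $T$. **Corollary.** Let $A$ and $B$ be rings, ${}_AN_B$ and ${}_BM_A$ bimodules, and let $\Lambda=\begin{pmatrix}A&N\\ M&B\end{pmatrix}$ be the Morita context ring with zero bimodule maps $N\otimes_BM\to A$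 and $M\otimes_AN\to B$, that is, with multiplication $$\begin{pmatrix}a&n\\ m&b\end{pmatrix}\begin{pmatrix}a'&n'\\ m'&b'\end{pmatrix}=\begin{pmatrix}aa'&an'+nb'\\ ma'+bm'&bb'\end{pmatrix}.$$ Assume that $\Lambda$ is a Noetherian algebra and that $N\otimes_BM=0=M\otimes_AN$. (Then $A$ and $B$, being quotient rings of $\Lambda$, are Noetherian algebras as well.) Then the following hold. 1. If $N_B$, $M_A$, ${}_AN$ and ${}_BM$ are projective, then $$\max\{\mathrm{IT}(A),\mathrm{IT}(B)\}\le\mathrm{IT}(\Lambda)\le2\max\{\mathrm{IT}(A),\mathrm{IT}(B)\}+1.$$ 2. If $N_B$ and $M_A$ are projective, then $$\max\{\dim A,\dim B\}\le\dim\Lambda\le2\max\{\dim A,\dim B\}+1.$$ 3. If $\mathrm{Tor}_i^B(N,M)=0=\mathrm{Tor}_i^A(M,N)$ for all $i\ge1$, and ${}_AN$ and ${}_BM$ have finite projective dimension, then $$\max\{\mathrm{der.dim}\,\mathbf{D}^b(\mathrm{mod}\,A),\mathrm{der.dim}\,\mathbf{D}^b(\mathrm{mod}\,B)\}\le\mathrm{der.dim}\,\mathbf{D}^b(\mathrm{mod}\,\Lambda)$$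 $$\le2\max\{\mathrm{der.dim}\,\mathbf{D}^b(\mathrm{mod}\,A),\mathrm{der.dim}\,\mathbf{D}^b(\mathrm{mod}\,B)\}+1.$$ -/

import Mathlib

open CategoryTheory Limits MulOpposite
open scoped TensorProduct

universe v u

noncomputable section

/-! ### Morita context rings with zero bimodule maps -/

/-- The underlying set of the Morita context ring with rows `(A, N)` and `(M, B)`, where `N` is an
`A`-`B`-bimodule and `M` is a `B`-`A`-bimodule. Right module structures are written as module
structures over the opposite ring. -/
@[ext]
structure MoritaContextRing (A B M N : Type u) : Type u where
  a : A
  n : N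
  m : M
  b : B

namespace MoritaContextRing

variable {A B M N : Type u} [Ring A] [Ring B] [AddCommGroup M] [AddCommGroup N]

instance : Zero (MoritaContextRing A B M N) := ⟨⟨0, 0, 0, 0⟩⟩
instance : One (MoritaContextRing A B M N) := ⟨⟨1, 0, 0, 1⟩⟩
instance : Add (MoritaContextRing A B M N) :=
  ⟨fun x y => ⟨x.a + y.a, x.n + y.n, x.m + y.m, x.b + y.b⟩⟩
instance : Neg (MoritaContextRing A B M N) := ⟨fun x => ⟨-x.a, -x.n, -x.m, -x.b⟩⟩

/-- Matrix multiplication, where both bimodule maps `N ⊗_B M → A` and `M ⊗_A N → B` are zero: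
`(a, n; m, b) (a', n'; m', b') = (a a', a n' + n b'; m a' + b m', b b')`. -/
instance [Module A N] [Module Bᵐᵒᵖ N] [Module B M] [Module Aᵐᵒᵖ M] :
    Mul (MoritaContextRing A B M N) :=
  ⟨fun x y => ⟨x.a * y.a, x.a • y.n + op y.b • x.n, op y.a • x.m + x.b • y.m, x.b * y.b⟩⟩

@[simp] lemma zero_a : (0 : MoritaContextRing A B M N).a = 0 := rfl
@[simp] lemma zero_n : (0 : MoritaContextRing A B M N).n = 0 := rfl
@[simp] lemma zero_m : (0 : MoritaContextRing A B M N).m = 0 := rfl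
@[simp] lemma zero_b : (0 : MoritaContextRing A B M N).b = 0 := rfl
@[simp] lemma one_a : (1 : MoritaContextRing A B M N).a = 1 := rfl
@[simp] lemma one_n : (1 : MoritaContextRing A B M N).n = 0 := rfl
@[simp] lemma one_m : (1 : MoritaContextRing A B M N).m = 0 := rfl
@[simp] lemma one_b : (1 : MoritaContextRing A B M N).b = 1 := rfl

section

variable (x y : MoritaContextRing A B M N)

@[simp] lemma add_a : (x + y).a = x.a + y.a := rfl
@[simp] lemma add_n : (x + y).n = x.n + y.n := rfl
@[simp] lemma add_m : (x + y).m = x.m + y.m := rfl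
@[simp] lemma add_b : (x + y).b = x.b + y.b := rfl
@[simp] lemma neg_a : (-x).a = -x.a := rfl
@[simp] lemma neg_n : (-x).n = -x.n := rfl
@[simp] lemma neg_m : (-x).m = -x.m := rfl
@[simp] lemma neg_b : (-x).b = -x.b := rfl

variable [Module A N] [Module Bᵐᵒᵖ N] [Module B M] [Module Aᵐᵒᵖ M]

@[simp] lemma mul_a : (x * y).a = x.a * y.a := rfl
@[simp] lemma mul_n : (x * y).n = x.a • y.n + op y.b • x.n := rfl
@[simp] lemma mul_m : (x * y).m = op y.a • x.m + x.b • y.m := rfl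
@[simp] lemma mul_b : (x * y).b = x.b * y.b := rfl

end

variable [Module A N] [Module Bᵐᵒᵖ N] [SMulCommClass A Bᵐᵒᵖ N]
  [Module B M] [Module Aᵐᵒᵖ M] [SMulCommClass B Aᵐᵒᵖ M]

instance : Ring (MoritaContextRing A B M N) where
  add_assoc x y z := by ext <;> simp [add_assoc]
  zero_add x := by ext <;> simp
  add_zero x := by ext <;> simp
  add_comm x y := by ext <;> simp [add_comm]
  neg_add_cancel x := by ext <;> simp
  nsmul := nsmulRec
  zsmul := zsmulRec
  left_distrib x y z := by ext <;> simp [mul_add, add_smul] <;> abel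
  right_distrib x y z := by ext <;> simp [add_mul, add_smul] <;> abel
  zero_mul x := by ext <;> simp
  mul_zero x := by ext <;> simp
  mul_assoc x y z := by
    ext
    · simp [mul_assoc]
    · simp [mul_smul, smul_comm x.a (op z.b), add_assoc]
    · simp [mul_smul, smul_comm x.b (op z.a), add_assoc]
    · simp [mul_assoc]
  one_mul x := by ext <;> simp
  mul_one x := by ext <;> simp

variable (A B M N)

/-- The projection of the Morita context ring onto `A`. -/
def projLeft : MoritaContextRing A B M N →+* A where
  toFun x := x.a
  map_one' := rfl
  map_mul' _ _ := rfl
  map_zero' := rfl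
  map_add' _ _ := rfl

/-- The projection of the Morita context ring onto `B`. -/
def projRight : MoritaContextRing A B M N →+* B where
  toFun x := x.b
  map_one' := rfl
  map_mul' _ _ := rfl
  map_zero' := rfl
  map_add' _ _ := rfl

lemma projLeft_surjective : Function.Surjective (projLeft A B M N) :=
  fun a => ⟨⟨a, 0, 0, 0⟩, rfl⟩

lemma projRight_surjective : Function.Surjective (projRight A B M N) :=
  fun b => ⟨⟨0, 0, 0, b⟩, rfl⟩

end MoritaContextRing

/-! ### Noetherian algebras and their finitely generated right modules -/

/-- A Noetherian algebra: a ring that is a module-finite algebra over some commutative Noetherian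
ring `R`. (Replacing `R` by its image in the center of `Λ`, its universe does not matter.) -/
class IsNoetherianAlgebra (Λ : Type u) [Ring Λ] : Prop where
  exists_finite_algebra : ∃ (R : Type u) (_ : CommRing R) (_ : IsNoetherianRing R)
    (_ : Algebra R Λ), Module.Finite R Λ

/-- Noetherian algebras are right Noetherian. -/
instance IsNoetherianAlgebra.isNoetherianRing_op (Λ : Type u) [Ring Λ]
    [h : IsNoetherianAlgebra Λ] : IsNoetherianRing Λᵐᵒᵖ := by
  obtain ⟨R, _, _, _, _⟩ := h.exists_finite_algebra
  have : Module.Finite R Λᵐᵒᵖ := Module.Finite.equiv (MulOpposite.opLinearEquiv R (M := Λ))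
  exact IsNoetherianRing.of_finite R Λᵐᵒᵖ

/-- A quotient of a Noetherian algebra is a Noetherian algebra. -/
lemma IsNoetherianAlgebra.of_surjective {Λ Γ : Type u} [Ring Λ] [Ring Γ]
    (h : IsNoetherianAlgebra Λ) (f : Λ →+* Γ) (hf : Function.Surjective f) :
    IsNoetherianAlgebra Γ := by
  obtain ⟨R, _, _, _, _⟩ := h.exists_finite_algebra
  let _ : Algebra R Γ := (f.comp (algebraMap R Λ)).toAlgebra' (by
    intro r x
    obtain ⟨y, rfl⟩ := hf x
    simp only [RingHom.comp_apply, ← map_mul, Algebra.commutes])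
  let g : Λ →ₗ[R] Γ :=
    { toFun := f
      map_add' := map_add f
      map_smul' := fun r x => by
        rw [Algebra.smul_def, map_mul, RingHom.id_apply, Algebra.smul_def]; rfl }
  exact ⟨R, inferInstance, inferInstance, inferInstance, Module.Finite.of_surjective g hf⟩

namespace MoritaContextRing

variable {A B M N : Type u} [Ring A] [Ring B] [AddCommGroup M] [AddCommGroup N]
  [Module A N] [Module Bᵐᵒᵖ N] [SMulCommClass A Bᵐᵒᵖ N]
  [Module B M] [Module Aᵐᵒᵖ M] [SMulCommClass B Aᵐᵒᵖ M]

lemma isNoetherianAlgebra_left (h : IsNoetherianAlgebra (MoritaContextRing A B M N)) :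
    IsNoetherianAlgebra A :=
  h.of_surjective _ (projLeft_surjective A B M N)

lemma isNoetherianAlgebra_right (h : IsNoetherianAlgebra (MoritaContextRing A B M N)) :
    IsNoetherianAlgebra B :=
  h.of_surjective _ (projRight_surjective A B M N)

end MoritaContextRing

/-- The category `mod-Λ` of finitely generated right `Λ`-modules. It is abelian when `Λ` is a
Noetherian algebra. -/
abbrev FGRightMod (Λ : Type u) [Ring Λ] := FGModuleCat.{u} Λᵐᵒᵖ

/-! ### Igusa-Todorov distance and extension dimension of an abelian category -/

section Abelian

attribute [local instance] Abelian.hasFiniteBiproducts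

variable {C : Type u} [Category.{v} C] [Abelian C]

/-- `add 𝒰`: direct summands of finite direct sums of objects of `𝒰`. -/
def addClosure (𝒰 : ObjectProperty C) : ObjectProperty C := fun X =>
  ∃ (k : ℕ) (V : Fin k → C), (∀ i, 𝒰 (V i)) ∧ Nonempty (Retract X (⨁ V))

/-- `K` is an `n`-th syzygy of `X`: for `n = 0` it is isomorphic to `X`, and an `(n + 1)`-st syzygy
is the kernel of an epimorphism from a projective object onto an `n`-th syzygy. (Syzygies are
unique only up to projective direct summands, so this is a relation.) -/
def IsSyzygy : ℕ → C → C → Prop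
  | 0, X, K => Nonempty (K ≅ X)
  | n + 1, X, K => ∃ (L P : C) (i : K ⟶ P) (p : P ⟶ L) (w : i ≫ p = 0),
      IsSyzygy n X L ∧ Projective P ∧ (ShortComplex.mk i p w).ShortExact

/-- There is an exact sequence `0 ⟶ U_m ⟶ ⋯ ⟶ U_1 ⟶ U_0 ⟶ X ⟶ 0` with all `U_i` in `𝒰`. For
`m = 0` this is an isomorphism `U_0 ≅ X`; for `m + 1` it is the splice of a short exact sequence
`0 ⟶ K ⟶ U_0 ⟶ X ⟶ 0` and an exact sequence `0 ⟶ U_{m+1} ⟶ ⋯ ⟶ U_1 ⟶ K ⟶ 0`. -/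
def HasLeftResolution (𝒰 : ObjectProperty C) : ℕ → C → Prop
  | 0, X => ∃ U : C, 𝒰 U ∧ Nonempty (U ≅ X)
  | m + 1, X => ∃ (K U : C) (i : K ⟶ U) (p : U ⟶ X) (w : i ≫ p = 0),
      𝒰 U ∧ HasLeftResolution 𝒰 m K ∧ (ShortComplex.mk i p w).ShortExact

variable (C) in
/-- `C` is an `(m, n)`-Igusa-Todorov category: for some object `U`, every object `X` has an `n`-th
syzygy `K` with an exact sequence `0 ⟶ U_m ⟶ ⋯ ⟶ U_0 ⟶ K ⟶ 0`, where all `U_i` lie in `add U`. -/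
def IsIgusaTodorovCategory (m n : ℕ) : Prop :=
  ∃ U : C, ∀ X : C, ∃ K : C, IsSyzygy n X K ∧
    HasLeftResolution (addClosure (ObjectProperty.singleton U)) m K

variable (C) in
/-- The Igusa-Todorov distance of `C`; it is `⊤` if `C` is not an `(m, n)`-Igusa-Todorov category
for any `m` and `n`. -/
def igusaTodorovDistance : ℕ∞ :=
  ⨅ m ∈ {m : ℕ | ∃ n : ℕ, IsIgusaTodorovCategory C m n}, (m : ℕ∞)

/-- `𝒰 • 𝒱 = add {X | there is an exact sequence 0 ⟶ U ⟶ X ⟶ V ⟶ 0 with U ∈ 𝒰 and V ∈ 𝒱}`. -/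
def extensionBullet (𝒰 𝒱 : ObjectProperty C) : ObjectProperty C :=
  addClosure fun X => ∃ (U V : C) (i : U ⟶ X) (p : X ⟶ V) (w : i ≫ p = 0),
    𝒰 U ∧ 𝒱 V ∧ (ShortComplex.mk i p w).ShortExact

/-- `[𝒰]_0 = 0`, `[𝒰]_1 = add 𝒰`, and `[𝒰]_{n+2} = [𝒰]_1 • [𝒰]_{n+1}`. -/
def extensionLayer (𝒰 : ObjectProperty C) : ℕ → ObjectProperty C
  | 0 => fun X => IsZero X
  | 1 => addClosure 𝒰
  | n + 2 => extensionBullet (addClosure 𝒰) (extensionLayer 𝒰 (n + 1))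

variable (C) in
/-- The extension dimension of `C`: the least `n` with `C = [T]_{n+1}` for some object `T`, and `⊤`
if there is no such `n`. -/
def extensionDimension : ℕ∞ :=
  ⨅ n ∈ {n : ℕ | ∃ T : C, ∀ X : C, extensionLayer (ObjectProperty.singleton T) (n + 1) X}, (n : ℕ∞)

end Abelian

/-! ### Rouquier dimension -/

/-- The (Rouquier) dimension of a triangulated category: the least `n` such that, for some object
`T`, every object lies in `⟨T⟩_{n+1}`, and `⊤` if there is no such `n`. Here `⟨T⟩_1` consists of the
direct summands of finite direct sums of shifts of `T`, and `⟨T⟩_{n+1}` consists of the direct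
summands of objects `X` in triangles `U ⟶ X ⟶ V ⟶ U[1]` with `U` in `⟨T⟩_1` and `V` in `⟨T⟩_n`;
Mathlib's `triangEnvelopeIter n` (at most `n` extensions) is `⟨T⟩_{n+1}`. -/
def rouquierDimension (T : Type u) [Category.{v} T] [HasZeroObject T] [HasShift T ℤ]
    [Preadditive T] [∀ n : ℤ, (shiftFunctor T n).Additive] [Pretriangulated T] : ℕ∞ :=
  ⨅ n ∈ {n : ℕ | ∃ X : T, ∀ Y : T, (ObjectProperty.singleton X).triangEnvelopeIter n Y}, (n : ℕ∞)

/-- The Rouquier dimension of the bounded derived category of an abelian category. -/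
def rouquierDimensionBoundedDerived (C : Type u) [Category.{v} C] [Abelian C] : ℕ∞ :=
  letI : HasDerivedCategory C := HasDerivedCategory.standard C
  rouquierDimension (DerivedCategory.Bounded C)

/-! ### Tensor products and Tor over a noncommutative ring -/

section Tor

variable (R : Type u) [Ring R] (X : Type u) [AddCommGroup X] [Module Rᵐᵒᵖ X]

/-- The subgroup of `X ⊗_ℤ Y` generated by the elements `x r ⊗ y - x ⊗ r y`. -/
def balancedRelations (Y : Type u) [AddCommGroup Y] [Module R Y] : AddSubgroup (X ⊗[ℤ] Y) :=
  AddSubgroup.closure {z | ∃ (x : X) (r : R) (y : Y), z = (op r • x) ⊗ₜ[ℤ] y - x ⊗ₜ[ℤ] (r • y)}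

/-- The tensor product `X ⊗_R Y` of a right `R`-module `X` and a left `R`-module `Y`. -/
abbrev BalancedTensor (Y : Type u) [AddCommGroup Y] [Module R Y] : Type u :=
  (X ⊗[ℤ] Y) ⧸ balancedRelations R X Y

variable {R} in
/-- The map `X ⊗_R Y → X ⊗_R Z` induced by an `R`-linear map `Y → Z`. -/
def BalancedTensor.map {Y Z : Type u} [AddCommGroup Y] [Module R Y] [AddCommGroup Z] [Module R Z]
    (f : Y →ₗ[R] Z) : BalancedTensor R X Y →+ BalancedTensor R X Z :=
  QuotientAddGroup.map _ _ (LinearMap.lTensor X f.toAddMonoidHom.toIntLinearMap).toAddMonoidHom (by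
    refine (AddSubgroup.closure_le _).2 ?_
    rintro _ ⟨x, r, y, rfl⟩
    refine AddSubgroup.subset_closure ⟨x, r, f y, ?_⟩
    rw [map_sub]
    exact congrArg (fun z => (op r • x) ⊗ₜ[ℤ] f y - x ⊗ₜ[ℤ] z) (map_smul f r y))

variable {R X} in
lemma BalancedTensor.hom_ext {Y Z : Type u} [AddCommGroup Y] [Module R Y] [AddCommGroup Z]
    {f g : BalancedTensor R X Y →+ Z}
    (h : ∀ x y, f (QuotientAddGroup.mk (x ⊗ₜ[ℤ] y)) = g (QuotientAddGroup.mk (x ⊗ₜ[ℤ] y))) :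
    f = g := by
  refine QuotientAddGroup.addMonoidHom_ext _ (AddMonoidHom.ext fun z => ?_)
  induction z using TensorProduct.induction_on with
  | zero => rw [map_zero, map_zero]
  | tmul x y => exact h x y
  | add a b ha hb => rw [map_add, map_add, ha, hb]

/-- The functor `X ⊗_R -` from left `R`-modules to abelian groups. -/
def balancedTensorFunctor : ModuleCat.{u} R ⥤ AddCommGrpCat.{u} where
  obj Y := AddCommGrpCat.of (BalancedTensor R X Y)
  map f := AddCommGrpCat.ofHom (BalancedTensor.map X f.hom)
  map_id _ := AddCommGrpCat.hom_ext (BalancedTensor.hom_ext fun _ _ => rfl)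
  map_comp _ _ := AddCommGrpCat.hom_ext (BalancedTensor.hom_ext fun _ _ => rfl)

instance : (balancedTensorFunctor R X).Additive where
  map_add {_ _ f g} := AddCommGrpCat.hom_ext (BalancedTensor.hom_ext fun x y =>
    congrArg QuotientAddGroup.mk (TensorProduct.tmul_add x (f.hom y) (g.hom y)))

/-- `Tor_i^R(X, Y)` for a right `R`-module `X` and a left `R`-module `Y`: the `i`-th left derived
functor of `X ⊗_R -`, evaluated at `Y`. -/
def balancedTor (i : ℕ) (Y : Type u) [AddCommGroup Y] [Module R Y] : AddCommGrpCat.{u} :=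
  ((balancedTensorFunctor R X).leftDerived i).obj (ModuleCat.of R Y)

end Tor

end

universe w w₁ w₂ v₁ v₂ u₁ u₂

noncomputable section

section Abelian

attribute [local instance] Abelian.hasFiniteBiproducts

variable {C : Type u} [Category.{v} C] [Abelian C]

/-! ### Additive closures -/

/-! Let `J` be the common kernel of the two projections of `Λ` onto `A` and `B`, that is, the
off-diagonal part. Both bimodule maps vanish, so `J² = 0`, and `Λ / J = A × B`. For a module `X`,
both the part `X'` killed by `J` and the quotient `X / X'` are killed by `J`, hence split along the
two diagonal idempotents into modules inflated from `A` and `B`. So every `X` is an extension of one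
such sum by another, functorially in `X` (`twoStepFiltration`). If modules over `A` and `B` are
built in `m + 1` layers from one object, then `Λ`-modules need at most `2(m + 1)` layers, whence the
bound `2m + 1`. The lower bounds come from the exact corner functors `X ↦ X e`, of which inflation
is a section.

For the extension dimension this is the whole argument, once summands are taken only at the end
(`extensionLayer_succ_iff`). For the Rouquier dimension, the filtration functors are merely
additive; applied termwise to a bounded complex they give a short exact sequence of complexes, hence
a triangle (`rouquierDimension_bounded_le`).

For the Igusa–Todorov distance, resolutions of length `m` of syzygies are exchanged for filtrations
with `m + 1` layers of possibly higher syzygies (`igusaTodorovDistance_le_iff`), which the horseshoe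
lemma can splice. Inflation does not preserve projectives, but it raises projective dimension by at
most one: `0 → N → e₁Λ → A → 0` is a projective resolution over `Λ`, since `N ⊗_B M = 0` makes the
inflation of the projective module `N_B` projective (`projective_inflation`), and symmetrically for
`M`. Projectivity of `N_B` and `M_A` also makes the corner functors preserve projectives
(`preservesProjectiveObjects`). -/

lemma addClosure_of_retract_biproduct {𝒰 : ObjectProperty C} {ι : Type} [Finite ι] {V : ι → C}
    (hV : ∀ i, 𝒰 (V i)) {X : C} (r : Retract X (⨁ V)) : addClosure 𝒰 X := by
  obtain ⟨k, ⟨e⟩⟩ := Finite.exists_equiv_fin ι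
  exact ⟨k, V ∘ e.symm, fun i => hV _, ⟨r.trans (Retract.ofIso (biproduct.reindex e.symm V).symm)⟩⟩

lemma addClosure.of_retract {𝒰 : ObjectProperty C} {X Y : C} (hY : addClosure 𝒰 Y)
    (r : Retract X Y) : addClosure 𝒰 X := by
  obtain ⟨k, V, hV, ⟨s⟩⟩ := hY
  exact ⟨k, V, hV, ⟨r.trans s⟩⟩

lemma addClosure.of_iso {𝒰 : ObjectProperty C} {X Y : C} (hY : addClosure 𝒰 Y)
    (e : X ≅ Y) : addClosure 𝒰 X :=
  hY.of_retract (Retract.ofIso e)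

lemma addClosure_of_isZero (𝒰 : ObjectProperty C) {X : C} (hX : IsZero X) : addClosure 𝒰 X :=
  addClosure_of_retract_biproduct (ι := Empty) (V := fun i => i.elim) (fun i => i.elim)
    ⟨0, 0, hX.eq_of_src _ _⟩

lemma le_addClosure (𝒰 : ObjectProperty C) : 𝒰 ≤ addClosure 𝒰 := fun X hX =>
  addClosure_of_retract_biproduct (ι := Unit) (V := fun _ => X) (fun _ => hX)
    ⟨biproduct.ι (fun _ : Unit => X) (), biproduct.π (fun _ : Unit => X) (),
      biproduct.ι_π_self _ _⟩

/-- A biproduct indexed by a disjoint union contains the biproduct of the partial biproducts. -/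
def biproductSumRetract {ι κ : Type} [Finite ι] [Finite κ] (U : ι ⊕ κ → C) :
    Retract ((⨁ fun i => U (.inl i)) ⊞ ⨁ fun j => U (.inr j)) (⨁ U) where
  i := biprod.desc (biproduct.desc fun i => biproduct.ι U (.inl i))
    (biproduct.desc fun j => biproduct.ι U (.inr j))
  r := biprod.lift (biproduct.lift fun i => biproduct.π U (.inl i))
    (biproduct.lift fun j => biproduct.π U (.inr j))
  retract := by
    classical
    ext i j
    · by_cases h : i = j
      · subst h; simp
      · simp [biproduct.ι_π_ne _ h, biproduct.ι_π_ne U (fun h' => h (Sum.inl.inj h'))]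
    · simp [biproduct.ι_π_ne U (show (Sum.inl i : ι ⊕ κ) ≠ .inr j by simp)]
    · simp [biproduct.ι_π_ne U (show (Sum.inr i : ι ⊕ κ) ≠ .inl j by simp)]
    · by_cases h : i = j
      · subst h; simp
      · simp [biproduct.ι_π_ne _ h, biproduct.ι_π_ne U (fun h' => h (Sum.inr.inj h'))]

lemma addClosure.biprod {𝒰 : ObjectProperty C} {X Y : C} (hX : addClosure 𝒰 X)
    (hY : addClosure 𝒰 Y) : addClosure 𝒰 (X ⊞ Y) := by
  obtain ⟨k, V, hV, ⟨r⟩⟩ := hX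
  obtain ⟨l, W, hW, ⟨s⟩⟩ := hY
  refine addClosure_of_retract_biproduct (ι := Fin k ⊕ Fin l) (V := Sum.elim V W)
    (by rintro (i | i); exacts [hV i, hW i])
    (Retract.trans (Y := (⨁ V) ⊞ ⨁ W) ?_ (biproductSumRetract (Sum.elim V W)))
  exact ⟨biprod.map r.i s.i, biprod.map r.r s.r, by ext <;> simp⟩

/-- The biproduct of `n + 1` objects is the biproduct of the first one and the others. -/
def biproductFinSuccRetract {n : ℕ} (V : Fin (n + 1) → C) :
    Retract (⨁ V) (V 0 ⊞ ⨁ fun i : Fin n => V i.succ) where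
  i := biprod.lift (biproduct.π V 0) (biproduct.lift fun i => biproduct.π V i.succ)
  r := biprod.desc (biproduct.ι V 0) (biproduct.desc fun i => biproduct.ι V i.succ)
  retract := by
    rw [biprod.lift_desc, ← biproduct.total (f := V), Fin.sum_univ_succ, biproduct.lift_desc]

/-- Induction on the number of summands, splitting off one at a time. It serves as an induction
principle for additive closures, so that later arguments never handle finite families. -/
lemma addClosure_le {𝒰 𝒬 : ObjectProperty C} (hzero : ∀ X, IsZero X → 𝒬 X)
    (hbiprod : ∀ X Y, 𝒬 X → 𝒬 Y → 𝒬 (X ⊞ Y)) (hretract : ∀ X Y, Retract X Y → 𝒬 Y → 𝒬 X)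
    (h : 𝒰 ≤ 𝒬) : addClosure 𝒰 ≤ 𝒬 := by
  rintro X ⟨k, V, hV, ⟨r⟩⟩
  refine hretract _ _ r ?_
  clear r
  induction k with
  | zero =>
    refine hzero _ ((IsZero.iff_id_eq_zero _).2 ?_)
    ext i
    exact i.elim0
  | succ n ih =>
    exact hretract _ _ (biproductFinSuccRetract V) (hbiprod _ _ (h _ (hV 0)) (ih _ fun i => hV _))

lemma addClosure_le_addClosure {𝒰 𝒱 : ObjectProperty C} (h : 𝒰 ≤ addClosure 𝒱) :
    addClosure 𝒰 ≤ addClosure 𝒱 :=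
  addClosure_le (fun _ => addClosure_of_isZero 𝒱) (fun _ _ h₁ h₂ => h₁.biprod h₂)
    (fun _ _ r h₁ => h₁.of_retract r) h

lemma addClosure_singleton_le {T : C} {𝒱 : ObjectProperty C} (h : addClosure 𝒱 T) :
    addClosure (.singleton T) ≤ addClosure 𝒱 :=
  addClosure_le_addClosure fun X hX => by
    obtain rfl := (ObjectProperty.singleton_iff _ _).1 hX
    exact h

lemma addClosure_singleton_self (T : C) : addClosure (.singleton T) T :=
  le_addClosure _ _ (by simp)

lemma addClosure_singleton_biprod_left (T T' : C) :
    addClosure (.singleton T) ≤ addClosure (.singleton (T ⊞ T')) :=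
  addClosure_singleton_le ((addClosure_singleton_self _).of_retract
    ⟨biprod.inl, biprod.fst, by simp⟩)

lemma addClosure_singleton_biprod_right (T T' : C) :
    addClosure (.singleton T') ≤ addClosure (.singleton (T ⊞ T')) :=
  addClosure_singleton_le ((addClosure_singleton_self _).of_retract
    ⟨biprod.inr, biprod.snd, by simp⟩)

lemma addClosure_singleton_map {D : Type u} [Category.{v} D] [Abelian D] (F : C ⥤ D) [F.Additive]
    (T : C) {X : C} (hX : addClosure (.singleton T) X) :
    addClosure (.singleton (F.obj T)) (F.obj X) := by
  refine addClosure_le (𝒬 := fun X => addClosure (.singleton (F.obj T)) (F.obj X)) ?_ ?_ ?_ ?_ X hX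
  · exact fun X hX => addClosure_of_isZero _ (F.map_isZero hX)
  · have := preservesBinaryBiproducts_of_preservesBiproducts F
    exact fun X Y hX hY => (hX.biprod hY).of_iso (F.mapBiprod X Y)
  · exact fun X Y r hY => hY.of_retract (r.map F)
  · intro X hX
    obtain rfl := (ObjectProperty.singleton_iff _ _).1 hX
    exact addClosure_singleton_self _

/-! ### Short exact sequences -/

/-- The direct sum of two short exact sequences. -/
lemma shortExact_biprod {X₁ X₂ X₃ Y₁ Y₂ Y₃ : C} {i : X₁ ⟶ X₂} {p : X₂ ⟶ X₃} {w : i ≫ p = 0}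
    {j : Y₁ ⟶ Y₂} {q : Y₂ ⟶ Y₃} {w' : j ≫ q = 0} (h : (ShortComplex.mk i p w).ShortExact)
    (h' : (ShortComplex.mk j q w').ShortExact) :
    (ShortComplex.mk (biprod.map i j) (biprod.map p q)
      (by ext <;> simp [w, w'])).ShortExact := by
  have := h.mono_f
  have := h'.mono_f
  have := h.epi_g
  have := h'.epi_g
  dsimp at *
  refine { exact := ?_, mono_f := ?_, epi_g := ?_ }
  · rw [ShortComplex.exact_iff_exact_up_to_refinements]
    intro A x hx
    dsimp at x hx
    have h1 : (x ≫ biprod.fst) ≫ p = 0 := by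
      simpa using hx =≫ biprod.fst
    have h2 : (x ≫ biprod.snd) ≫ q = 0 := by
      simpa using hx =≫ biprod.snd
    obtain ⟨y, hy⟩ := h.exact.lift' _ h1
    obtain ⟨z, hz⟩ := h'.exact.lift' _ h2
    dsimp at y z hy hz
    refine ⟨A, 𝟙 A, inferInstance, biprod.lift y z, ?_⟩
    dsimp
    ext <;> simp [hy, hz]
  · dsimp
    refine Preadditive.mono_of_cancel_zero _ fun {A} x hx => ?_
    ext
    · rw [← cancel_mono i]
      simpa using hx =≫ biprod.fst
    · rw [← cancel_mono j]
      simpa using hx =≫ biprod.snd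
  · dsimp
    refine Preadditive.epi_of_cancel_zero _ fun {A} x hx => ?_
    ext
    · rw [← cancel_epi p]
      simpa using biprod.inl ≫= hx
    · rw [← cancel_epi q]
      simpa using biprod.inr ≫= hx

/-- The kernels of an epimorphism of short exact sequences form a short exact sequence. -/
lemma exists_shortExact_kernels {X₁ X₂ X₃ Q₁ Q₂ Q₃ K₁ K₃ : C}
    {f : X₁ ⟶ X₂} {g : X₂ ⟶ X₃} {w : f ≫ g = 0} (h : (ShortComplex.mk f g w).ShortExact)
    {f' : Q₁ ⟶ Q₂} {g' : Q₂ ⟶ Q₃} {w' : f' ≫ g' = 0} (h' : (ShortComplex.mk f' g' w').ShortExact)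
    {i₁ : K₁ ⟶ Q₁} {p₁ : Q₁ ⟶ X₁} {w₁ : i₁ ≫ p₁ = 0} (h₁ : (ShortComplex.mk i₁ p₁ w₁).ShortExact)
    {i₃ : K₃ ⟶ Q₃} {p₃ : Q₃ ⟶ X₃} {w₃ : i₃ ≫ p₃ = 0} (h₃ : (ShortComplex.mk i₃ p₃ w₃).ShortExact)
    (p₂ : Q₂ ⟶ X₂) (c₁ : f' ≫ p₂ = p₁ ≫ f) (c₂ : g' ≫ p₃ = p₂ ≫ g) :
    ∃ (K₂ : C) (i₂ : K₂ ⟶ Q₂) (w₂ : i₂ ≫ p₂ = 0) (a : K₁ ⟶ K₂) (b : K₂ ⟶ K₃) (w₀ : a ≫ b = 0),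
      (ShortComplex.mk i₂ p₂ w₂).ShortExact ∧ (ShortComplex.mk a b w₀).ShortExact := by
  have := h.mono_f
  have := h.epi_g
  have := h'.mono_f
  have := h'.epi_g
  have := h₁.mono_f
  have := h₁.epi_g
  have := h₃.mono_f
  have := h₃.epi_g
  dsimp at *
  let a : K₁ ⟶ kernel p₂ := kernel.lift _ (i₁ ≫ f') (by
    rw [Category.assoc, c₁, reassoc_of% w₁, zero_comp])
  obtain ⟨b, hb⟩ := h₃.exact.lift' (kernel.ι p₂ ≫ g') (by simp [c₂])
  dsimp at b hb
  have ha : a ≫ kernel.ι p₂ = i₁ ≫ f' := kernel.lift_ι _ _ _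
  have w₀ : a ≫ b = 0 := by
    rw [← cancel_mono i₃, Category.assoc, hb, reassoc_of% ha, w', comp_zero, zero_comp]
  -- Four-lemma argument: lift the image in `X₃` through `Q₂`; the error then lies in `X₁` and is
  -- lifted through `p₁`.
  have hp₂ : Epi p₂ := by
    rw [epi_iff_surjective_up_to_refinements]
    intro A x
    obtain ⟨A', π, _, y, hy⟩ := surjective_up_to_refinements_of_epi (g' ≫ p₃) (x ≫ g)
    obtain ⟨z, hz⟩ := h.exact.lift' (π ≫ x - y ≫ p₂) (by simp [hy, c₂])
    dsimp at z hz
    obtain ⟨A'', π', _, t, ht⟩ := surjective_up_to_refinements_of_epi p₁ z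
    refine ⟨A'', π' ≫ π, inferInstance, t ≫ f' + π' ≫ y, ?_⟩
    have := π' ≫= hz
    rw [reassoc_of% ht] at this
    simp only [Preadditive.comp_sub] at this
    simp [c₁, this]
  refine ⟨kernel p₂, kernel.ι p₂, kernel.condition _, a, b, w₀, ?_, ?_⟩
  · exact { exact := ShortComplex.exact_of_f_is_kernel _ (kernelIsKernel p₂) }
  · refine { exact := ?_, mono_f := ?_, epi_g := ?_ }
    · rw [ShortComplex.exact_iff_exact_up_to_refinements]
      intro A x hx
      dsimp at x hx
      obtain ⟨y, hy⟩ := h'.exact.lift' (x ≫ kernel.ι p₂) (by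
        dsimp
        rw [Category.assoc, ← hb, reassoc_of% hx, zero_comp])
      dsimp at y hy
      obtain ⟨z, hz⟩ := h₁.exact.lift' y (by
        dsimp
        rw [← cancel_mono f, Category.assoc, ← c₁, reassoc_of% hy, kernel.condition, comp_zero,
          zero_comp])
      dsimp at z hz
      refine ⟨A, 𝟙 A, inferInstance, z, ?_⟩
      dsimp
      rw [← cancel_mono (kernel.ι p₂)]
      simp [ha, reassoc_of% hz, hy]
    · dsimp
      have : Mono (a ≫ kernel.ι p₂) := by rw [ha]; infer_instance
      exact mono_of_mono a (kernel.ι p₂)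
    · dsimp
      rw [epi_iff_surjective_up_to_refinements]
      intro A x
      obtain ⟨A', π, _, y, hy⟩ := surjective_up_to_refinements_of_epi g' (x ≫ i₃)
      obtain ⟨z, hz⟩ := h.exact.lift' (y ≫ p₂) (by
        dsimp
        rw [Category.assoc, ← c₂, ← reassoc_of% hy, w₃, comp_zero, comp_zero])
      dsimp at z hz
      obtain ⟨A'', π', _, t, ht⟩ := surjective_up_to_refinements_of_epi p₁ z
      -- The lift `y` of `x` need only map into `X₁`. Because `p₁` is epi, an element of `Q₁`
      -- corrects it to lie in the kernel of `p₂`; this is the vanishing of the snake map.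
      have key : (π' ≫ y - t ≫ f') ≫ p₂ = 0 := by
        simp only [Preadditive.sub_comp, Category.assoc, c₁, ← hz]
        rw [reassoc_of% ht, sub_self]
      refine ⟨A'', π' ≫ π, inferInstance, kernel.lift p₂ _ key, ?_⟩
      rw [← cancel_mono i₃]
      simp only [Category.assoc, hb, kernel.lift_ι_assoc, Preadditive.sub_comp, w', comp_zero,
        sub_zero, hy]

lemma shortExact_inl_snd (X Y : C) :
    (ShortComplex.mk (biprod.inl : X ⟶ X ⊞ Y) biprod.snd (by simp)).ShortExact :=
  (ShortComplex.Splitting.ofHasBinaryBiproduct X Y).shortExact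

/-- The one-step horseshoe lemma; only the right-hand epimorphism needs a projective source. -/
lemma exists_horseshoe {X₁ X₂ X₃ Q₁ Q₃ K₁ K₃ : C}
    {f : X₁ ⟶ X₂} {g : X₂ ⟶ X₃} {w : f ≫ g = 0} (h : (ShortComplex.mk f g w).ShortExact)
    {i₁ : K₁ ⟶ Q₁} {p₁ : Q₁ ⟶ X₁} {w₁ : i₁ ≫ p₁ = 0} (h₁ : (ShortComplex.mk i₁ p₁ w₁).ShortExact)
    {i₃ : K₃ ⟶ Q₃} {p₃ : Q₃ ⟶ X₃} {w₃ : i₃ ≫ p₃ = 0} (h₃ : (ShortComplex.mk i₃ p₃ w₃).ShortExact)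
    [Projective Q₃] :
    ∃ (K₂ : C) (i₂ : K₂ ⟶ Q₁ ⊞ Q₃) (p₂ : Q₁ ⊞ Q₃ ⟶ X₂) (w₂ : i₂ ≫ p₂ = 0)
      (a : K₁ ⟶ K₂) (b : K₂ ⟶ K₃) (w₀ : a ≫ b = 0),
      (ShortComplex.mk i₂ p₂ w₂).ShortExact ∧ (ShortComplex.mk a b w₀).ShortExact := by
  have := h.epi_g
  dsimp at this
  obtain ⟨K₂, i₂, w₂, a, b, w₀, H⟩ := exists_shortExact_kernels h (shortExact_inl_snd Q₁ Q₃) h₁ h₃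
    (biprod.desc (p₁ ≫ f) (Projective.factorThru p₃ g)) (by simp) (by ext <;> simp [w])
  exact ⟨K₂, i₂, _, w₂, a, b, w₀, H⟩

lemma shortExact_of_iso_left {X₁ X₂ X₃ Y : C} {f : X₁ ⟶ X₂} {g : X₂ ⟶ X₃} {w : f ≫ g = 0}
    (h : (ShortComplex.mk f g w).ShortExact) (e : Y ≅ X₁) :
    (ShortComplex.mk (e.hom ≫ f) g (by simp [w])).ShortExact := by
  refine ShortComplex.shortExact_of_iso ?_ h
  exact ShortComplex.isoMk e.symm (Iso.refl _) (Iso.refl _) (by simp) (by simp)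

lemma shortExact_of_iso_right {X₁ X₂ X₃ Y : C} {f : X₁ ⟶ X₂} {g : X₂ ⟶ X₃} {w : f ≫ g = 0}
    (h : (ShortComplex.mk f g w).ShortExact) (e : X₃ ≅ Y) :
    (ShortComplex.mk f (g ≫ e.hom) (by simp [reassoc_of% w])).ShortExact := by
  refine ShortComplex.shortExact_of_iso ?_ h
  exact ShortComplex.isoMk (Iso.refl _) (Iso.refl _) e (by simp) (by simp)

lemma shortExact_zero_id {Z : C} (hZ : IsZero Z) (X : C) :
    (ShortComplex.mk (0 : Z ⟶ X) (𝟙 X) (by simp)).ShortExact :=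
  have : Mono (0 : Z ⟶ X) := ⟨fun _ _ _ => hZ.eq_of_tgt _ _⟩
  { exact := (ShortComplex.exact_iff_mono _ rfl).2 inferInstance }

lemma shortExact_kernel {X Y : C} (p : X ⟶ Y) [Epi p] :
    (ShortComplex.mk (kernel.ι p) p (kernel.condition p)).ShortExact :=
  { exact := ShortComplex.exact_of_f_is_kernel _ (kernelIsKernel p) }

/-- If `X₁ ⊆ X₂` and `Y₁ ⊆ X₁`, then `X₂ / Y₁` is an extension of `X₂ / X₁` by `X₁ / Y₁`. -/
lemma exists_shortExact_quotient {X₁ X₂ X₃ Y₁ Y₃ : C}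
    {f : X₁ ⟶ X₂} {g : X₂ ⟶ X₃} {w : f ≫ g = 0} (h : (ShortComplex.mk f g w).ShortExact)
    {i : Y₁ ⟶ X₁} {p : X₁ ⟶ Y₃} {w' : i ≫ p = 0} (h' : (ShortComplex.mk i p w').ShortExact) :
    ∃ (Q : C) (q : X₂ ⟶ Q) (wq : (i ≫ f) ≫ q = 0) (a : Y₃ ⟶ Q) (b : Q ⟶ X₃) (w₀ : a ≫ b = 0),
      (ShortComplex.mk (i ≫ f) q wq).ShortExact ∧ (ShortComplex.mk a b w₀).ShortExact := by
  have := h.mono_f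
  have := h.epi_g
  have := h'.mono_f
  have := h'.epi_g
  dsimp at *
  let q := cokernel.π (i ≫ f)
  have hq : (ShortComplex.mk (i ≫ f) q (cokernel.condition _)).ShortExact :=
    { exact := ShortComplex.exact_of_g_is_cokernel _ (cokernelIsCokernel _) }
  obtain ⟨a, ha⟩ : ∃ a : Y₃ ⟶ cokernel (i ≫ f), p ≫ a = f ≫ q :=
    h'.exact.desc' (f ≫ q) (by dsimp; rw [← Category.assoc, cokernel.condition])
  let b : cokernel (i ≫ f) ⟶ X₃ := cokernel.desc _ g (by simp [w])
  have hb : q ≫ b = g := cokernel.π_desc _ _ _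
  have w₀ : a ≫ b = 0 := by
    rw [← cancel_epi p, reassoc_of% ha, hb, w, comp_zero]
  refine ⟨_, q, cokernel.condition _, a, b, w₀, hq, ?_⟩
  refine { exact := ?_, mono_f := ?_, epi_g := ?_ }
  · rw [ShortComplex.exact_iff_exact_up_to_refinements]
    intro A x hx
    dsimp at x hx
    obtain ⟨A', π, _, y, hy⟩ := surjective_up_to_refinements_of_epi q x
    obtain ⟨z, hz⟩ := h.exact.lift' y (by
      have : y ≫ q ≫ b = 0 := by rw [← reassoc_of% hy, hx, comp_zero]
      rwa [hb] at this)
    dsimp at z hz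
    exact ⟨A', π, inferInstance, z ≫ p, by dsimp; rw [hy, ← hz, Category.assoc, Category.assoc, ha]⟩
  · dsimp
    refine Preadditive.mono_of_cancel_zero _ fun {A} x hx => ?_
    obtain ⟨A', π, _, y, hy⟩ := surjective_up_to_refinements_of_epi p x
    obtain ⟨z, hz⟩ := hq.exact.lift' (y ≫ f) (by
      dsimp
      rw [Category.assoc, ← ha, ← reassoc_of% hy, hx, comp_zero])
    dsimp at z hz
    rw [← Category.assoc, cancel_mono] at hz
    rw [← cancel_epi π, hy, ← hz, Category.assoc, w', comp_zero, comp_zero]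
  · have : Epi (q ≫ b) := by rw [hb]; infer_instance
    exact epi_of_epi q b

end Abelian


section Abelian

open ZeroObject

attribute [local instance] Abelian.hasFiniteBiproducts

variable {C : Type u} [Category.{v} C] [Abelian C]

/-- If all members of `S` exceed `N`, then `N + 1` is a lower bound. This turns a finite bound on
any of the three dimensions into the existence of a generator. -/
lemma iInf_natCast_le_iff (S : Set ℕ) (N : ℕ) :
    (⨅ m ∈ S, (m : ℕ∞)) ≤ N ↔ ∃ m ∈ S, m ≤ N := by
  constructor
  · intro h
    by_contra! h'
    have : ((N + 1 : ℕ) : ℕ∞) ≤ ⨅ m ∈ S, (m : ℕ∞) :=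
      le_iInf₂ fun m hm => Nat.cast_le.2 (h' m hm)
    have := Nat.cast_le.1 (this.trans h)
    lia
  · rintro ⟨m, hm, h⟩
    exact (iInf₂_le m hm).trans (Nat.cast_le.2 h)

/-- Kernels of a composition of epimorphisms. -/
lemma exists_shortExact_kernel_comp {K P U X L : C} {i : K ⟶ P} {p : P ⟶ U} {w : i ≫ p = 0}
    (h : (ShortComplex.mk i p w).ShortExact) {j : L ⟶ U} {q : U ⟶ X} {w' : j ≫ q = 0}
    (h' : (ShortComplex.mk j q w').ShortExact) :
    ∃ (M : C) (k : M ⟶ P) (wk : k ≫ p ≫ q = 0) (a : K ⟶ M) (b : M ⟶ L) (w₀ : a ≫ b = 0),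
      (ShortComplex.mk k (p ≫ q) wk).ShortExact ∧ (ShortComplex.mk a b w₀).ShortExact := by
  have := h.mono_f
  have := h.epi_g
  have := h'.mono_f
  have := h'.epi_g
  dsimp at *
  have : Epi (p ≫ q) := epi_comp _ _
  obtain ⟨b, hb⟩ := h'.exact.lift' (kernel.ι (p ≫ q) ≫ p) (by
    dsimp
    rw [Category.assoc, kernel.condition])
  dsimp at b hb
  let a : K ⟶ kernel (p ≫ q) := kernel.lift _ i (by rw [reassoc_of% w, zero_comp])
  have ha : a ≫ kernel.ι (p ≫ q) = i := kernel.lift_ι _ _ _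
  have w₀ : a ≫ b = 0 := by
    rw [← cancel_mono j, Category.assoc, hb, reassoc_of% ha, w, zero_comp]
  refine ⟨_, _, kernel.condition _, a, b, w₀, shortExact_kernel _,
    { exact := ?_, mono_f := ?_, epi_g := ?_ }⟩
  · rw [ShortComplex.exact_iff_exact_up_to_refinements]
    intro A x hx
    dsimp at x hx
    obtain ⟨y, hy⟩ := h.exact.lift' (x ≫ kernel.ι (p ≫ q)) (by
      dsimp
      rw [Category.assoc, ← hb, reassoc_of% hx, zero_comp])
    dsimp at y hy
    refine ⟨A, 𝟙 A, inferInstance, y, ?_⟩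
    dsimp
    rw [← cancel_mono (kernel.ι (p ≫ q))]
    simp [ha, hy]
  · dsimp
    have : Mono (a ≫ kernel.ι (p ≫ q)) := by rw [ha]; infer_instance
    exact mono_of_mono a (kernel.ι (p ≫ q))
  · dsimp
    rw [epi_iff_surjective_up_to_refinements]
    intro A x
    obtain ⟨A', π, _, y, hy⟩ := surjective_up_to_refinements_of_epi p (x ≫ j)
    refine ⟨A', π, inferInstance, kernel.lift (p ≫ q) y ?_, ?_⟩
    · rw [← reassoc_of% hy, w', comp_zero, comp_zero]
    · rw [← cancel_mono j]
      simp [hb, hy]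

/-! ### Syzygies -/

lemma IsSyzygy.of_iso_right {n : ℕ} {X K K' : C} (h : IsSyzygy n X K) (e : K' ≅ K) :
    IsSyzygy n X K' := by
  cases n with
  | zero =>
    obtain ⟨f⟩ := h
    exact ⟨e ≪≫ f⟩
  | succ n =>
    obtain ⟨L, P, i, p, w, hL, hP, H⟩ := h
    exact ⟨L, P, _, p, _, hL, hP, shortExact_of_iso_left H e⟩

lemma IsSyzygy.of_iso_left {n : ℕ} {X X' K : C} (h : IsSyzygy n X K) (e : X ≅ X') :
    IsSyzygy n X' K := by
  induction n generalizing K with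
  | zero =>
    obtain ⟨f⟩ := h
    exact ⟨f ≪≫ e⟩
  | succ n ih =>
    obtain ⟨L, P, i, p, w, hL, hP, H⟩ := h
    exact ⟨L, P, i, p, w, ih hL, hP, H⟩

lemma IsSyzygy.comp {m n : ℕ} {X L K : C} (h : IsSyzygy m X L) (h' : IsSyzygy n L K) :
    IsSyzygy (m + n) X K := by
  induction n generalizing K with
  | zero =>
    obtain ⟨f⟩ := h'
    exact h.of_iso_right f
  | succ n ih =>
    obtain ⟨L', P, i, p, w, hL, hP, H⟩ := h'
    exact ⟨L', P, i, p, w, ih hL, hP, H⟩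

lemma isSyzygy_one_iff {X K : C} : IsSyzygy 1 X K ↔
    ∃ (P : C) (i : K ⟶ P) (p : P ⟶ X) (w : i ≫ p = 0),
      Projective P ∧ (ShortComplex.mk i p w).ShortExact := by
  constructor
  · rintro ⟨L, P, i, p, w, ⟨e⟩, hP, H⟩
    exact ⟨P, i, _, _, hP, shortExact_of_iso_right H e⟩
  · rintro ⟨P, i, p, w, hP, H⟩
    exact ⟨X, P, i, p, w, ⟨Iso.refl _⟩, hP, H⟩

lemma IsSyzygy.biprod {n : ℕ} {X Y K L : C} (h : IsSyzygy n X K) (h' : IsSyzygy n Y L) :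
    IsSyzygy n (X ⊞ Y) (K ⊞ L) := by
  induction n generalizing K L with
  | zero =>
    obtain ⟨f⟩ := h
    obtain ⟨g⟩ := h'
    exact ⟨biprod.mapIso f g⟩
  | succ n ih =>
    obtain ⟨K', P, i, p, w, hK, hP, H⟩ := h
    obtain ⟨L', Q, j, q, w', hL, hQ, H'⟩ := h'
    exact ⟨_, _, _, _, _, ih hK hL, inferInstance, shortExact_biprod H H'⟩

/-- The horseshoe lemma. -/
lemma IsSyzygy.horseshoe {n : ℕ} {X₁ X₂ X₃ K₁ K₃ : C} {f : X₁ ⟶ X₂} {g : X₂ ⟶ X₃}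
    {w : f ≫ g = 0} (h : (ShortComplex.mk f g w).ShortExact) (h₁ : IsSyzygy n X₁ K₁)
    (h₃ : IsSyzygy n X₃ K₃) :
    ∃ (K₂ : C) (a : K₁ ⟶ K₂) (b : K₂ ⟶ K₃) (w₀ : a ≫ b = 0), IsSyzygy n X₂ K₂ ∧
      (ShortComplex.mk a b w₀).ShortExact := by
  induction n generalizing K₁ K₃ with
  | zero =>
    obtain ⟨e₁⟩ := h₁
    obtain ⟨e₃⟩ := h₃
    exact ⟨X₂, _, _, _, ⟨Iso.refl _⟩,
      shortExact_of_iso_right (shortExact_of_iso_left h e₁) e₃.symm⟩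
  | succ n ih =>
    obtain ⟨L₁, P₁, i₁, p₁, w₁, hL₁, hP₁, H₁⟩ := h₁
    obtain ⟨L₃, P₃, i₃, p₃, w₃, hL₃, hP₃, H₃⟩ := h₃
    obtain ⟨L₂, a, b, w₀, hL₂, H₂⟩ := ih hL₁ hL₃
    obtain ⟨K₂, i₂, p₂, w₂, a', b', w₀', H, H'⟩ := exists_horseshoe H₂ H₁ H₃
    exact ⟨K₂, a', b', w₀', ⟨L₂, _, i₂, p₂, w₂, hL₂, inferInstance, H⟩, H'⟩

lemma isIso_of_shortExact_of_isZero {X₁ X₂ X₃ : C} {f : X₁ ⟶ X₂} {g : X₂ ⟶ X₃}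
    {w : f ≫ g = 0} (h : (ShortComplex.mk f g w).ShortExact) (h₁ : IsZero X₁) : IsIso g := by
  have : Epi g := h.epi_g
  have : Mono g := (ShortComplex.exact_iff_mono _ (h₁.eq_of_src _ _)).1 h.exact
  exact isIso_of_mono_of_epi g

/-- If `X₂` is an extension of `X₃` by `X₁` and `K` is the kernel of an epimorphism from a
projective object `P` onto `X₃`, then `K` is also the kernel of an epimorphism `X₁ ⊞ P ⟶ X₂`. -/
lemma exists_shortExact_of_projective {X₁ X₂ X₃ K P : C} {f : X₁ ⟶ X₂} {g : X₂ ⟶ X₃}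
    {w : f ≫ g = 0} (h : (ShortComplex.mk f g w).ShortExact)
    {i : K ⟶ P} {p : P ⟶ X₃} {w' : i ≫ p = 0} (h' : (ShortComplex.mk i p w').ShortExact)
    [Projective P] :
    ∃ (j : K ⟶ X₁ ⊞ P) (q : X₁ ⊞ P ⟶ X₂) (wq : j ≫ q = 0),
      (ShortComplex.mk j q wq).ShortExact := by
  -- Horseshoe with the identity of `X₁` on the left, whose kernel is zero; the middle kernel is
  -- then identified with `K`.
  obtain ⟨K₂, i₂, p₂, w₂, a, b, w₀, H, H'⟩ :=
    exists_horseshoe h (shortExact_zero_id (isZero_zero C) X₁) h'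
  have := isIso_of_shortExact_of_isZero H' (isZero_zero C)
  exact ⟨_, _, _, shortExact_of_iso_left H (asIso b).symm⟩

section

variable {D : Type u} [Category.{v} D] [Abelian D] (F : C ⥤ D) [F.Additive]
  [PreservesFiniteLimits F] [PreservesFiniteColimits F]

lemma shortExact_map {X₁ X₂ X₃ : C} {f : X₁ ⟶ X₂} {g : X₂ ⟶ X₃} {w : f ≫ g = 0}
    (h : (ShortComplex.mk f g w).ShortExact) :
    (ShortComplex.mk (F.map f) (F.map g) (by rw [← F.map_comp, w, F.map_zero])).ShortExact :=
  h.map_of_exact F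

lemma IsSyzygy.map [F.PreservesProjectiveObjects] {n : ℕ} {X K : C} (h : IsSyzygy n X K) :
    IsSyzygy n (F.obj X) (F.obj K) := by
  induction n generalizing K with
  | zero =>
    obtain ⟨f⟩ := h
    exact ⟨F.mapIso f⟩
  | succ n ih =>
    obtain ⟨L, P, i, p, w, hL, hP, H⟩ := h
    exact ⟨_, _, _, _, _, ih hL, F.projective_obj_of_projective hP, shortExact_map F H⟩

lemma HasLeftResolution.map {𝒰 : ObjectProperty C} {𝒱 : ObjectProperty D}
    (h𝒰 : ∀ X, 𝒰 X → 𝒱 (F.obj X)) {m : ℕ} {X : C} (h : HasLeftResolution 𝒰 m X) :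
    HasLeftResolution 𝒱 m (F.obj X) := by
  induction m generalizing X with
  | zero =>
    obtain ⟨U, hU, ⟨e⟩⟩ := h
    exact ⟨_, h𝒰 _ hU, ⟨F.mapIso e⟩⟩
  | succ m ih =>
    obtain ⟨K, U, i, p, w, hU, hK, H⟩ := h
    exact ⟨_, _, _, _, _, h𝒰 _ hU, ih hK, shortExact_map F H⟩

end

lemma HasLeftResolution.mono {𝒰 𝒱 : ObjectProperty C} (h𝒰 : 𝒰 ≤ 𝒱) {m : ℕ} {X : C}
    (h : HasLeftResolution 𝒰 m X) : HasLeftResolution 𝒱 m X :=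
  h.map (𝟭 C) h𝒰

/-! ### Iterated extensions -/

/-- The objects with a filtration of length `n + 1` whose subquotients lie in `𝒰`. -/
def IteratedExtension (𝒰 : ObjectProperty C) : ℕ → ObjectProperty C
  | 0 => 𝒰
  | n + 1 => fun X => ∃ (U V : C) (i : U ⟶ X) (p : X ⟶ V) (w : i ≫ p = 0),
      𝒰 U ∧ IteratedExtension 𝒰 n V ∧ (ShortComplex.mk i p w).ShortExact

namespace IteratedExtension

lemma mono {𝒰 𝒱 : ObjectProperty C} (h : 𝒰 ≤ 𝒱) {n : ℕ} {X : C}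
    (hX : IteratedExtension 𝒰 n X) : IteratedExtension 𝒱 n X := by
  induction n generalizing X with
  | zero => exact h _ hX
  | succ n ih =>
    obtain ⟨U, V, i, p, w, hU, hV, H⟩ := hX
    exact ⟨U, V, i, p, w, h _ hU, ih hV, H⟩

lemma map {D : Type u} [Category.{v} D] [Abelian D] (F : C ⥤ D) [F.Additive]
    [PreservesFiniteLimits F] [PreservesFiniteColimits F] {T : C} {n : ℕ} {X : C}
    (hX : IteratedExtension (addClosure (.singleton T)) n X) :
    IteratedExtension (addClosure (.singleton (F.obj T))) n (F.obj X) := by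
  induction n generalizing X with
  | zero => exact addClosure_singleton_map F T hX
  | succ n ih =>
    obtain ⟨U, V, i, p, w, hU, hV, H⟩ := hX
    exact ⟨_, _, _, _, _, addClosure_singleton_map F T hU, ih hV, shortExact_map F H⟩

variable {𝒰 : ObjectProperty C}

lemma succ {n : ℕ} {X : C} (hX : IteratedExtension (addClosure 𝒰) n X) :
    IteratedExtension (addClosure 𝒰) (n + 1) X :=
  ⟨0, X, 0, 𝟙 X, _, addClosure_of_isZero _ (isZero_zero C), hX,
    shortExact_zero_id (isZero_zero C) X⟩

lemma of_le {m n : ℕ} (h : m ≤ n) {X : C} (hX : IteratedExtension (addClosure 𝒰) m X) :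
    IteratedExtension (addClosure 𝒰) n X := by
  induction h with
  | refl => exact hX
  | step _ ih => exact ih.succ

lemma of_isZero (n : ℕ) {X : C} (hX : IsZero X) : IteratedExtension (addClosure 𝒰) n X :=
  of_le (m := 0) (Nat.zero_le n) (addClosure_of_isZero 𝒰 hX)

lemma biprod {n : ℕ} {X Y : C} (hX : IteratedExtension (addClosure 𝒰) n X)
    (hY : IteratedExtension (addClosure 𝒰) n Y) :
    IteratedExtension (addClosure 𝒰) n (X ⊞ Y) := by
  induction n generalizing X Y with
  | zero => exact addClosure.biprod hX hY
  | succ n ih =>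
    obtain ⟨U, V, i, p, w, hU, hV, H⟩ := hX
    obtain ⟨U', V', i', p', w', hU', hV', H'⟩ := hY
    exact ⟨_, _, _, _, _, hU.biprod hU', ih hV hV', shortExact_biprod H H'⟩

/-- Index `m` stands for `m + 1` layers, so concatenation has `(m + 1) + (n + 1)` layers and index
`m + n + 1`. The induction divides `X₂` by the bottom layer of `X₁`. -/
lemma extension {m n : ℕ} {X₁ X₂ X₃ : C} {f : X₁ ⟶ X₂} {g : X₂ ⟶ X₃} {w : f ≫ g = 0}
    (h : (ShortComplex.mk f g w).ShortExact) (h₁ : IteratedExtension (addClosure 𝒰) m X₁)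
    (h₃ : IteratedExtension (addClosure 𝒰) n X₃) :
    IteratedExtension (addClosure 𝒰) (m + n + 1) X₂ := by
  induction m generalizing X₁ X₂ with
  | zero => exact ⟨X₁, X₃, f, g, w, h₁, by rwa [Nat.zero_add], h⟩
  | succ m ih =>
    obtain ⟨U, V, i, p, w', hU, hV, H⟩ := h₁
    obtain ⟨Q, q, wq, a, b, w₀, H₁, H₂⟩ := exists_shortExact_quotient h H
    have := ih H₂ hV
    rw [Nat.add_right_comm m 1 n]
    exact ⟨U, Q, _, q, wq, hU, this, H₁⟩

end IteratedExtension

/-! ### Finite projective generators -/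

/-- Every object is a quotient of a projective object in `add G`. -/
def IsFiniteProjectiveGenerator (G : C) : Prop :=
  ∀ X : C, ∃ (P : C) (p : P ⟶ X), Projective P ∧ addClosure (.singleton G) P ∧ Epi p

namespace IsFiniteProjectiveGenerator

variable {G : C} (hG : IsFiniteProjectiveGenerator G)

include hG

lemma addClosure_of_projective (P : C) [Projective P] : addClosure (.singleton G) P := by
  obtain ⟨Q, q, _, hQ, _⟩ := hG P
  exact hQ.of_retract ⟨Projective.factorThru (𝟙 P) q, q, Projective.factorThru_comp _ _⟩

/-- By Schanuel's argument, a syzygy of a direct summand is a summand of a syzygy of the whole plus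
a projective. Including `G` in `T'` absorbs that projective. -/
lemma exists_isSyzygy_addClosure (T : C) : ∃ T' : C,
    ∀ U, addClosure (.singleton T) U → ∃ K, IsSyzygy 1 U K ∧ addClosure (.singleton T') K := by
  obtain ⟨P₀, p₀, hP₀, _, _⟩ := hG T
  refine ⟨kernel p₀ ⊞ G, addClosure_le ?_ ?_ ?_ ?_⟩
  · exact fun X hX => ⟨X, isSyzygy_one_iff.2 ⟨X, 0, 𝟙 X, by simp, ⟨fun f e _ =>
      ⟨0, hX.eq_of_src _ _⟩⟩, shortExact_zero_id hX X⟩, addClosure_of_isZero _ hX⟩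
  · rintro X Y ⟨K, hK, hK'⟩ ⟨L, hL, hL'⟩
    exact ⟨K ⊞ L, hK.biprod hL, hK'.biprod hL'⟩
  · rintro X Y r ⟨K, hK, hK'⟩
    obtain ⟨P, i, p, w, hP, H⟩ := isSyzygy_one_iff.1 hK
    obtain ⟨Q, q, hQ, hQ', _⟩ := hG X
    have := H.epi_g
    have := H.mono_f
    dsimp at *
    refine ⟨kernel q, isSyzygy_one_iff.2 ⟨Q, _, q, _, hQ, shortExact_kernel q⟩, ?_⟩
    let a : Q ⟶ P := Projective.factorThru (q ≫ r.i) p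
    have ha : a ≫ p = q ≫ r.i := Projective.factorThru_comp _ _
    let b : P ⟶ Q := Projective.factorThru (p ≫ r.r) q
    have hb : b ≫ q = p ≫ r.r := Projective.factorThru_comp _ _
    obtain ⟨c, hc⟩ := H.exact.lift' (kernel.ι q ≫ a) (by
      dsimp
      rw [Category.assoc, ha, kernel.condition_assoc, zero_comp])
    dsimp at c hc
    let d : K ⟶ kernel q := kernel.lift q (i ≫ b) (by
      rw [Category.assoc, hb, reassoc_of% w, zero_comp])
    -- The lifts `a` and `b` need not compose to the identity of `Q`, but `𝟙 Q - a ≫ b` lands in the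
    -- kernel of `q`. This gives the second summand in the decomposition of the identity of `kernel
    -- q` through `K ⊞ Q`.
    let e : Q ⟶ kernel q := kernel.lift q (𝟙 Q - a ≫ b) (by
      rw [Preadditive.sub_comp, Category.assoc, hb, reassoc_of% ha, r.retract]
      simp)
    have hQ'' : addClosure (.singleton (kernel p₀ ⊞ G)) Q :=
      addClosure_singleton_biprod_right _ _ _ hQ'
    refine (hK'.biprod hQ'').of_retract
      ⟨biprod.lift c (kernel.ι q), biprod.desc d e, ?_⟩
    rw [← cancel_mono (kernel.ι q), biprod.lift_desc, Preadditive.add_comp, Category.assoc,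
      Category.assoc, kernel.lift_ι, kernel.lift_ι, reassoc_of% hc]
    simp
  · intro X hX
    obtain rfl := (ObjectProperty.singleton_iff _ _).1 hX
    exact ⟨kernel p₀, isSyzygy_one_iff.2 ⟨P₀, _, p₀, _, hP₀, shortExact_kernel p₀⟩,
      addClosure_singleton_biprod_left _ _ _ (addClosure_singleton_self _)⟩

/-- The horseshoe lemma, layer by layer, transports a filtration to a syzygy. The length is kept,
and `T'` works for all lengths at once. -/
lemma exists_isSyzygy_one (T : C) : ∃ T' : C, ∀ n X,
    IteratedExtension (addClosure (.singleton T)) n X → ∃ K, IsSyzygy 1 X K ∧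
      IteratedExtension (addClosure (.singleton T')) n K := by
  obtain ⟨T', hT'⟩ := hG.exists_isSyzygy_addClosure T
  refine ⟨T', fun n => ?_⟩
  induction n with
  | zero => exact hT'
  | succ n ih =>
    rintro X ⟨U, V, i, p, w, hU, hV, H⟩
    obtain ⟨K, hK, hK'⟩ := hT' U hU
    obtain ⟨L, hL, hL'⟩ := ih V hV
    obtain ⟨M, a, b, w₀, hM, H'⟩ := IsSyzygy.horseshoe H hK hL
    exact ⟨M, hM, K, L, a, b, w₀, hK', hL', H'⟩

lemma exists_isSyzygy (T : C) (j : ℕ) : ∃ T' : C, ∀ n X,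
    IteratedExtension (addClosure (.singleton T)) n X → ∃ K, IsSyzygy j X K ∧
      IteratedExtension (addClosure (.singleton T')) n K := by
  induction j with
  | zero => exact ⟨T, fun n X hX => ⟨X, ⟨Iso.refl _⟩, hX⟩⟩
  | succ j ih =>
    obtain ⟨T₁, h₁⟩ := ih
    obtain ⟨T₂, h₂⟩ := hG.exists_isSyzygy_one T₁
    refine ⟨T₂, fun n X hX => ?_⟩
    obtain ⟨K, hK, hK'⟩ := h₁ n X hX
    obtain ⟨L, hL, hL'⟩ := h₂ n K hK'
    exact ⟨L, hK.comp hL, hL'⟩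

/-- From `0 → X₁ → U₀ → X → 0` one gets `0 → ΩU₀ → ΩX → X₁ → 0`. Taking `m` more syzygies and
inducting on `X₁`, the resolution `U_m → ⋯ → U₀` becomes a filtration of `Ω^m X` with layers
`Ω^{m-i} U_i`. -/
lemma exists_iteratedExtension_of_hasLeftResolution (U : C) (m : ℕ) : ∃ T' : C, ∀ X,
    HasLeftResolution (addClosure (.singleton U)) m X → ∃ K, IsSyzygy m X K ∧
      IteratedExtension (addClosure (.singleton T')) m K := by
  induction m with
  | zero =>
    refine ⟨U, ?_⟩
    rintro X ⟨V, hV, ⟨e⟩⟩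
    exact ⟨X, ⟨Iso.refl _⟩, hV.of_iso e.symm⟩
  | succ m ih =>
    obtain ⟨T₁, h₁⟩ := ih
    obtain ⟨T₂, h₂⟩ := hG.exists_isSyzygy_one U
    obtain ⟨T₃, h₃⟩ := hG.exists_isSyzygy T₂ m
    refine ⟨T₁ ⊞ T₃, ?_⟩
    rintro X ⟨X₁, U₀, i, p, w, hU₀, hX₁, H⟩
    obtain ⟨K₁, hK₁, hK₁'⟩ := h₁ X₁ hX₁
    obtain ⟨K₀, hK₀, hK₀'⟩ := h₂ 0 U₀ hU₀
    obtain ⟨S, hS, hS'⟩ := h₃ 0 K₀ hK₀'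
    obtain ⟨P, j, q, w', hP, H'⟩ := isSyzygy_one_iff.1 hK₀
    obtain ⟨L, k, wk, a, b, w₀, H₁, H₂⟩ := exists_shortExact_kernel_comp H' H
    obtain ⟨K', a', b', w₀', hK', H₃⟩ := IsSyzygy.horseshoe H₂ hS hK₁
    refine ⟨K', ?_, S, K₁, a', b', w₀', addClosure_singleton_biprod_right _ _ _ hS',
      hK₁'.mono (addClosure_singleton_biprod_left _ _), H₃⟩
    rw [Nat.add_comm]
    exact (isSyzygy_one_iff.2 ⟨P, k, _, wk, hP, H₁⟩).comp hK'

/-- An extension `0 → U → X → V → 0` and a projective cover term `P → V` with kernel `ΩV` give `0 →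
ΩV → U ⊞ P → X → 0`. As `ΩV` has a filtration one layer shorter than `X`, this iterates; `G`
accounts for the projectives `P`. -/
lemma exists_hasLeftResolution_of_iteratedExtension (T : C) (m : ℕ) : ∃ T' : C, ∀ X,
    IteratedExtension (addClosure (.singleton T)) m X →
      HasLeftResolution (addClosure (.singleton T')) m X := by
  induction m generalizing T with
  | zero => exact ⟨T, fun X hX => ⟨X, hX, ⟨Iso.refl _⟩⟩⟩
  | succ m ih =>
    obtain ⟨T₁, h₁⟩ := hG.exists_isSyzygy_one T
    obtain ⟨T₂, h₂⟩ := ih T₁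
    refine ⟨T₂ ⊞ (T ⊞ G), ?_⟩
    rintro X ⟨U, V, i, p, w, hU, hV, H⟩
    obtain ⟨K, hK, hK'⟩ := h₁ m V hV
    obtain ⟨P, j, q, w', hP, H'⟩ := isSyzygy_one_iff.1 hK
    obtain ⟨j', q', wq, H₂⟩ := exists_shortExact_of_projective H H'
    refine ⟨K, U ⊞ P, j', q', wq, ?_, (h₂ K hK').mono (addClosure_singleton_biprod_left _ _), H₂⟩
    exact addClosure_singleton_biprod_right _ _ _
      ((addClosure_singleton_biprod_left _ _ _ hU).biprod
        (addClosure_singleton_biprod_right _ _ _ (hG.addClosure_of_projective P)))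

/-- The order `n` of the syzygy is free in the definition, so it may grow by the length of the
resolution. Unlike resolutions, filtrations of bounded length behave additively under extensions. -/
lemma igusaTodorovDistance_le_iff (m : ℕ) : igusaTodorovDistance C ≤ m ↔
    ∃ (n : ℕ) (T : C), ∀ X : C, ∃ K, IsSyzygy n X K ∧
      IteratedExtension (addClosure (.singleton T)) m K := by
  refine (iInf_natCast_le_iff _ _).trans ⟨?_, ?_⟩
  · rintro ⟨k, ⟨n, U, hU⟩, hk⟩
    obtain ⟨T', hT'⟩ := hG.exists_iteratedExtension_of_hasLeftResolution U k
    refine ⟨n + k, T', fun X => ?_⟩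
    obtain ⟨K, hK, hK'⟩ := hU X
    obtain ⟨L, hL, hL'⟩ := hT' K hK'
    exact ⟨L, hK.comp hL, hL'.of_le hk⟩
  · rintro ⟨n, T, hT⟩
    obtain ⟨T', hT'⟩ := hG.exists_hasLeftResolution_of_iteratedExtension T m
    refine ⟨m, ⟨n, T', fun X => ?_⟩, le_rfl⟩
    obtain ⟨K, hK, hK'⟩ := hT X
    exact ⟨K, hK, hT' K hK'⟩

lemma exists_isSyzygy_of_le {m n N : ℕ} (hn : n ≤ N) {T : C} (hT : ∀ X : C, ∃ K, IsSyzygy n X K ∧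
      IteratedExtension (addClosure (.singleton T)) m K) :
    ∃ T' : C, ∀ X : C, ∃ K, IsSyzygy N X K ∧
      IteratedExtension (addClosure (.singleton T')) m K := by
  obtain ⟨k, rfl⟩ := Nat.exists_eq_add_of_le hn
  obtain ⟨T', hT'⟩ := hG.exists_isSyzygy T k
  refine ⟨T', fun X => ?_⟩
  obtain ⟨K, hK, hK'⟩ := hT X
  obtain ⟨L, hL, hL'⟩ := hT' m K hK'
  exact ⟨L, hK.comp hL, hL'⟩

end IsFiniteProjectiveGenerator

end Abelian


lemma ENat.le_two_mul_max_add_one {a b l : ℕ∞}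
    (h : ∀ m : ℕ, a ≤ m → b ≤ m → l ≤ (m + m + 1 : ℕ)) : l ≤ 2 * max a b + 1 := by
  obtain h' | ⟨m, hm⟩ : max a b = ⊤ ∨ ∃ m : ℕ, max a b = m := by
    induction max a b using ENat.recTopCoe with
    | top => exact .inl rfl
    | coe m => exact .inr ⟨m, rfl⟩
  · rw [h']
    exact le_top.trans_eq (by rfl)
  · have := h m ((le_max_left a b).trans hm.le) ((le_max_right a b).trans hm.le)
    rw [hm]
    refine this.trans_eq ?_
    push_cast
    rw [two_mul]

section Abelian

open ZeroObject

attribute [local instance] Abelian.hasFiniteBiproducts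

variable {C D E : Type u} [Category.{v} C] [Abelian C] [Category.{v} D] [Abelian D]
  [Category.{v} E] [Abelian E]

/-! ### The extension dimension via iterated extensions -/

lemma CategoryTheory.Retract.exists_iso_biprod {X Y : C} (r : Retract X Y) :
    ∃ Z : C, Nonempty (Y ≅ X ⊞ Z) := by
  have : IsSplitEpi r.r := ⟨⟨r.i, r.retract⟩⟩
  let s := ShortComplex.Splitting.ofExactOfSection _ (shortExact_kernel r.r).exact r.i r.retract
    inferInstance
  exact ⟨_, ⟨s.isoBinaryBiproduct ≪≫ biprod.braiding _ _⟩⟩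

/-- An extension of a direct summand of `Y₃` by a direct summand of `Y₁` is a direct summand of
an extension of `Y₃` by `Y₁`. -/
lemma exists_shortExact_of_retract {X₁ X₂ X₃ Y₁ Y₃ : C} {f : X₁ ⟶ X₂} {g : X₂ ⟶ X₃}
    {w : f ≫ g = 0} (h : (ShortComplex.mk f g w).ShortExact) (r₁ : Retract X₁ Y₁)
    (r₃ : Retract X₃ Y₃) :
    ∃ (Y₂ : C) (f' : Y₁ ⟶ Y₂) (g' : Y₂ ⟶ Y₃) (w' : f' ≫ g' = 0),
      (ShortComplex.mk f' g' w').ShortExact ∧ Nonempty (Retract X₂ Y₂) := by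
  obtain ⟨Z₁, ⟨e₁⟩⟩ := r₁.exists_iso_biprod
  obtain ⟨Z₃, ⟨e₃⟩⟩ := r₃.exists_iso_biprod
  exact ⟨_, _, _, _, shortExact_of_iso_right (shortExact_of_iso_left
    (shortExact_biprod h (shortExact_inl_snd Z₁ Z₃)) e₁) e₃.symm,
    ⟨biprod.inl, biprod.fst, by simp⟩⟩

lemma extensionLayer_add_two (𝒰 : ObjectProperty C) (n : ℕ) :
    extensionLayer 𝒰 (n + 1 + 1) = addClosure fun X =>
      ∃ (U V : C) (i : U ⟶ X) (p : X ⟶ V) (w : i ≫ p = 0),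
        addClosure 𝒰 U ∧ extensionLayer 𝒰 (n + 1) V ∧ (ShortComplex.mk i p w).ShortExact :=
  rfl

/-- Summands taken at every stage can be postponed to the end: complements of the outer terms are
added to the exact sequence, which makes its middle term a summand of a genuine extension. -/
lemma extensionLayer_succ_iff (𝒰 : ObjectProperty C) (n : ℕ) (X : C) :
    extensionLayer 𝒰 (n + 1) X ↔
      ∃ Y, IteratedExtension (addClosure 𝒰) n Y ∧ Nonempty (Retract X Y) := by
  induction n generalizing X with
  | zero =>
    exact ⟨fun h => ⟨X, h, ⟨Retract.refl X⟩⟩, fun ⟨Y, hY, ⟨r⟩⟩ => addClosure.of_retract hY r⟩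
  | succ n ih =>
    rw [extensionLayer_add_two]
    constructor
    · refine fun h => addClosure_le
        (𝒬 := fun X => ∃ Y, IteratedExtension (addClosure 𝒰) (n + 1) Y ∧ Nonempty (Retract X Y))
        ?_ ?_ ?_ ?_ X h
      · exact fun X hX => ⟨X, .of_isZero _ hX, ⟨Retract.refl X⟩⟩
      · rintro X Y ⟨X', hX', ⟨r⟩⟩ ⟨Y', hY', ⟨s⟩⟩
        exact ⟨X' ⊞ Y', hX'.biprod hY', ⟨biprod.map r.i s.i, biprod.map r.r s.r, by ext <;> simp⟩⟩
      · rintro X Y r ⟨Y', hY', ⟨s⟩⟩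
        exact ⟨Y', hY', ⟨r.trans s⟩⟩
      · rintro X ⟨U, V, i, p, w, hU, hV, H⟩
        obtain ⟨V', hV', ⟨r⟩⟩ := (ih V).1 hV
        obtain ⟨X', f', g', w', H', ⟨s⟩⟩ := exists_shortExact_of_retract H (Retract.refl U) r
        exact ⟨X', ⟨U, V', f', g', w', hU, hV', H'⟩, ⟨s⟩⟩
    · rintro ⟨Y, ⟨U, V, i, p, w, hU, hV, H⟩, ⟨r⟩⟩
      exact (le_addClosure _ _
        ⟨U, V, i, p, w, hU, (ih V).2 ⟨V, hV, ⟨Retract.refl V⟩⟩, H⟩).of_retract r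

lemma extensionDimension_le_iff (m : ℕ) : extensionDimension C ≤ m ↔
    ∃ T : C, ∀ X : C, ∃ Y, IteratedExtension (addClosure (.singleton T)) m Y ∧
      Nonempty (Retract X Y) := by
  refine (iInf_natCast_le_iff _ _).trans ⟨?_, ?_⟩
  · rintro ⟨k, ⟨T, hT⟩, hk⟩
    refine ⟨T, fun X => ?_⟩
    obtain ⟨Y, hY, hY'⟩ := (extensionLayer_succ_iff _ _ _).1 (hT X)
    exact ⟨Y, hY.of_le hk, hY'⟩
  · rintro ⟨T, hT⟩
    exact ⟨m, ⟨T, fun X => (extensionLayer_succ_iff _ _ _).2 (hT X)⟩, le_rfl⟩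

/-! ### Dimensions and essentially surjective exact functors -/

section

variable (R : C ⥤ D) [R.Additive] [PreservesFiniteLimits R] [PreservesFiniteColimits R]
  [R.EssSurj]

include R in
lemma extensionDimension_le_of_essSurj : extensionDimension D ≤ extensionDimension C := by
  refine le_iInf₂ fun m hm => ?_
  obtain ⟨T, hT⟩ := (extensionDimension_le_iff (C := C) m).1 (iInf₂_le m hm)
  refine (extensionDimension_le_iff m).2 ⟨R.obj T, fun X => ?_⟩
  obtain ⟨Y, hY, ⟨r⟩⟩ := hT (R.objPreimage X)
  exact ⟨R.obj Y, hY.map R, ⟨(Retract.ofIso (R.objObjPreimageIso X).symm).trans (r.map R)⟩⟩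

include R in
lemma igusaTodorovDistance_le_of_essSurj [R.PreservesProjectiveObjects] :
    igusaTodorovDistance D ≤ igusaTodorovDistance C := by
  refine le_iInf₂ fun m hm => ?_
  obtain ⟨n, U, hU⟩ := hm
  refine iInf₂_le m ⟨n, R.obj U, fun X => ?_⟩
  obtain ⟨K, hK, hK'⟩ := hU (R.objPreimage X)
  exact ⟨R.obj K, (hK.map R).of_iso_left (R.objObjPreimageIso X),
    hK'.map R fun V hV => addClosure_singleton_map R U hV⟩

end

/-! ### Syzygies and functors which raise the projective dimension by at most one -/

/-- If `Z` is an exact functor such that `Z P` has a projective first syzygy for all projective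
objects `P`, and `K` is an `n`-th syzygy of `W`, then first syzygies of `Z K` are
`(n + 1)`-st syzygies of `Z W`. -/
lemma IsSyzygy.map_succ (Z : C ⥤ D) [Z.Additive] [PreservesFiniteLimits Z]
    [PreservesFiniteColimits Z]
    (hZ : ∀ P : C, Projective P → ∃ Q, Projective Q ∧ IsSyzygy 1 (Z.obj P) Q)
    {n : ℕ} {W K : C} {L : D} (hK : IsSyzygy n W K) (hL : IsSyzygy 1 (Z.obj K) L) :
    IsSyzygy (n + 1) (Z.obj W) L := by
  induction n generalizing K L with
  | zero =>
    obtain ⟨e⟩ := hK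
    exact hL.of_iso_left (Z.mapIso e)
  | succ n ih =>
    obtain ⟨K', P, i, p, w, hK', hP, H⟩ := hK
    obtain ⟨Q₁, hQ₁, hQ₁'⟩ := hZ P hP
    obtain ⟨Q₀, i₀, p₀, w₀, hQ₀, H₀⟩ := isSyzygy_one_iff.1 hQ₁'
    -- With `0 → Q₁ → Q₀ → Z P → 0` projective, the kernel `M` of `Q₀ → Z P → Z K'` is a first
    -- syzygy of `Z K'` and an extension of `Z K` by `Q₁`. As `Q₁` is projective, the syzygy `L` of
    -- `Z K` is also a syzygy of `M`.
    obtain ⟨M, k, wk, a, b, w₁, H₁, H₂⟩ := exists_shortExact_kernel_comp H₀ (shortExact_map Z H)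
    obtain ⟨Q, j, q, w₂, hQ, H₃⟩ := isSyzygy_one_iff.1 hL
    obtain ⟨j', q', w₃, H₄⟩ := exists_shortExact_of_projective H₂ H₃
    exact (ih hK' (isSyzygy_one_iff.2 ⟨_, k, _, wk, hQ₀, H₁⟩)).comp
      (isSyzygy_one_iff.2 ⟨_, j', q', w₃, inferInstance, H₄⟩)

/-! ### Extensions of objects coming from two subcategories -/

section

variable (Z₁ : C ⥤ E) [Z₁.Additive] [PreservesFiniteLimits Z₁] [PreservesFiniteColimits Z₁]
  (Z₂ : D ⥤ E) [Z₂.Additive] [PreservesFiniteLimits Z₂] [PreservesFiniteColimits Z₂]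

lemma extensionDimension_le_of_shortExact
    (h : ∀ X : E, ∃ (U₁ V₁ : C) (U₂ V₂ : D) (i : Z₁.obj U₁ ⊞ Z₂.obj U₂ ⟶ X)
      (p : X ⟶ Z₁.obj V₁ ⊞ Z₂.obj V₂) (w : i ≫ p = 0), (ShortComplex.mk i p w).ShortExact) :
    extensionDimension E ≤ 2 * max (extensionDimension C) (extensionDimension D) + 1 := by
  refine ENat.le_two_mul_max_add_one fun m h₁ h₂ => ?_
  rw [extensionDimension_le_iff] at h₁ h₂ ⊢
  obtain ⟨T₁, hT₁⟩ := h₁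
  obtain ⟨T₂, hT₂⟩ := h₂
  have key (U₁ : C) (U₂ : D) : ∃ Y,
      IteratedExtension (addClosure (.singleton (Z₁.obj T₁ ⊞ Z₂.obj T₂))) m Y ∧
        Nonempty (Retract (Z₁.obj U₁ ⊞ Z₂.obj U₂) Y) := by
    obtain ⟨Y₁, hY₁, ⟨r₁⟩⟩ := hT₁ U₁
    obtain ⟨Y₂, hY₂, ⟨r₂⟩⟩ := hT₂ U₂
    exact ⟨Z₁.obj Y₁ ⊞ Z₂.obj Y₂,
      ((hY₁.map Z₁).mono (addClosure_singleton_biprod_left _ _)).biprod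
        ((hY₂.map Z₂).mono (addClosure_singleton_biprod_right _ _)),
      ⟨biprod.map (r₁.map Z₁).i (r₂.map Z₂).i, biprod.map (r₁.map Z₁).r (r₂.map Z₂).r,
        by ext <;> simp [← Functor.map_comp]⟩⟩
  refine ⟨Z₁.obj T₁ ⊞ Z₂.obj T₂, fun X => ?_⟩
  obtain ⟨U₁, V₁, U₂, V₂, i, p, w, H⟩ := h X
  obtain ⟨Y, hY, ⟨r⟩⟩ := key U₁ U₂
  obtain ⟨Y', hY', ⟨r'⟩⟩ := key V₁ V₂
  obtain ⟨Y₂, f', g', w', H', hr⟩ := exists_shortExact_of_retract H r r'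
  exact ⟨Y₂, .extension H' hY hY', hr⟩

/-- The orders for `C` and `D` are raised to their maximum, and one further syzygy is needed because
`Z₁` and `Z₂` send projectives to objects with a projective first syzygy only. Both ends of the
extension then have `m + 1` layers at the same syzygy order, and the horseshoe lemma joins them. -/
lemma igusaTodorovDistance_le_of_shortExact
    {G₁ : C} (hG₁ : IsFiniteProjectiveGenerator G₁) {G₂ : D} (hG₂ : IsFiniteProjectiveGenerator G₂)
    {G : E} (hG : IsFiniteProjectiveGenerator G)
    (hZ₁ : ∀ P : C, Projective P → ∃ Q, Projective Q ∧ IsSyzygy 1 (Z₁.obj P) Q)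
    (hZ₂ : ∀ P : D, Projective P → ∃ Q, Projective Q ∧ IsSyzygy 1 (Z₂.obj P) Q)
    (h : ∀ X : E, ∃ (U₁ V₁ : C) (U₂ V₂ : D) (i : Z₁.obj U₁ ⊞ Z₂.obj U₂ ⟶ X)
      (p : X ⟶ Z₁.obj V₁ ⊞ Z₂.obj V₂) (w : i ≫ p = 0), (ShortComplex.mk i p w).ShortExact) :
    igusaTodorovDistance E ≤ 2 * max (igusaTodorovDistance C) (igusaTodorovDistance D) + 1 := by
  refine ENat.le_two_mul_max_add_one fun m h₁ h₂ => ?_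
  rw [hG₁.igusaTodorovDistance_le_iff] at h₁
  rw [hG₂.igusaTodorovDistance_le_iff] at h₂
  rw [hG.igusaTodorovDistance_le_iff]
  obtain ⟨n₁, T₁, hT₁⟩ := h₁
  obtain ⟨n₂, T₂, hT₂⟩ := h₂
  obtain ⟨T₁', hT₁'⟩ := hG₁.exists_isSyzygy_of_le (le_max_left n₁ n₂) hT₁
  obtain ⟨T₂', hT₂'⟩ := hG₂.exists_isSyzygy_of_le (le_max_right n₁ n₂) hT₂
  obtain ⟨S₁, hS₁⟩ := hG.exists_isSyzygy_one (Z₁.obj T₁')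
  obtain ⟨S₂, hS₂⟩ := hG.exists_isSyzygy_one (Z₂.obj T₂')
  have key (U₁ : C) (U₂ : D) : ∃ L, IsSyzygy (max n₁ n₂ + 1) (Z₁.obj U₁ ⊞ Z₂.obj U₂) L ∧
      IteratedExtension (addClosure (.singleton (S₁ ⊞ S₂))) m L := by
    obtain ⟨K₁, hK₁, hK₁'⟩ := hT₁' U₁
    obtain ⟨K₂, hK₂, hK₂'⟩ := hT₂' U₂
    obtain ⟨L₁, hL₁, hL₁'⟩ := hS₁ m _ (hK₁'.map Z₁)
    obtain ⟨L₂, hL₂, hL₂'⟩ := hS₂ m _ (hK₂'.map Z₂)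
    exact ⟨L₁ ⊞ L₂, (hK₁.map_succ Z₁ hZ₁ hL₁).biprod (hK₂.map_succ Z₂ hZ₂ hL₂),
      (hL₁'.mono (addClosure_singleton_biprod_left _ _)).biprod
        (hL₂'.mono (addClosure_singleton_biprod_right _ _))⟩
  refine ⟨max n₁ n₂ + 1, S₁ ⊞ S₂, fun X => ?_⟩
  obtain ⟨U₁, V₁, U₂, V₂, i, p, w, H⟩ := h X
  obtain ⟨L, hL, hL'⟩ := key U₁ U₂
  obtain ⟨M, hM, hM'⟩ := key V₁ V₂
  obtain ⟨K, a, b, w₀, hK, H'⟩ := IsSyzygy.horseshoe H hL hM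
  exact ⟨K, hK, .extension H' hL' hM'⟩

end

end Abelian


/-! ### Closure properties of iterated triangulated envelopes -/

namespace CategoryTheory.ObjectProperty

open Pretriangulated

lemma isClosedUnderLimitsOfShape_retractClosure {C : Type u} [Category.{v} C]
    (P : ObjectProperty C) (J : Type) [HasLimitsOfShape (Discrete J) C]
    [P.IsClosedUnderLimitsOfShape (Discrete J)] :
    P.retractClosure.IsClosedUnderLimitsOfShape (Discrete J) where
  limitsOfShape_le := by
    rintro X ⟨p⟩
    choose Y hY r using fun j : J => p.prop_diag_obj ⟨j⟩
    let r (j : J) := (r j).some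
    refine ⟨∏ᶜ Y, P.prop_of_isLimit (limit.isLimit (Discrete.functor Y)) fun j => hY _,
      ⟨⟨Pi.lift fun j => p.π.app ⟨j⟩ ≫ (r j).i,
        p.isLimit.lift ⟨_, Discrete.natTrans fun j => Pi.π Y j.as ≫ (r j.as).r⟩, ?_⟩⟩⟩
    refine p.isLimit.hom_ext fun ⟨j⟩ => ?_
    simp [p.isLimit.fac, (r j).retract]

section

variable {C : Type u} [Category.{v} C] [HasZeroObject C] [HasShift C ℤ] [Preadditive C]
  [∀ n : ℤ, (shiftFunctor C n).Additive] [Pretriangulated C] (P Q : ObjectProperty C)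

/-- A product of distinguished triangles is distinguished. -/
lemma isClosedUnderLimitsOfShape_extensionProduct (J : Type) [Finite J]
    [P.IsClosedUnderLimitsOfShape (Discrete J)] [Q.IsClosedUnderLimitsOfShape (Discrete J)] :
    (extensionProduct P Q).IsClosedUnderLimitsOfShape (Discrete J) where
  limitsOfShape_le := by
    rintro X ⟨p⟩
    choose Y Z f g h hT hY hZ using fun j : J => p.prop_diag_obj ⟨j⟩
    have H := productTriangle_distinguished (fun j => Triangle.mk (f j) (g j) (h j)) hT
    let e : X ≅ ∏ᶜ fun j => p.diag.obj ⟨j⟩ :=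
      p.isLimit.conePointsIsoOfNatIso (limit.isLimit _) (Discrete.natIso fun j => Iso.refl _)
    refine prop_of_iso _ e.symm ⟨_, _, _, _, _, H,
      P.prop_of_isLimit (limit.isLimit (Discrete.functor Y)) fun j => hY _,
      Q.prop_of_isLimit (limit.isLimit (Discrete.functor Z)) fun j => hZ _⟩

lemma isClosedUnderLimitsOfShape_extensionProductIter (J : Type) [Finite J]
    [P.IsClosedUnderLimitsOfShape (Discrete J)] (n : ℕ) :
    (P.extensionProductIter n).IsClosedUnderLimitsOfShape (Discrete J) := by
  induction n with
  | zero => rwa [extensionProductIter_zero]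
  | succ n ih =>
    rw [extensionProductIter_succ]
    exact isClosedUnderLimitsOfShape_extensionProduct _ _ J

instance isClosedUnderBinaryProducts_triangEnvelopeIter (n : ℕ) :
    (P.triangEnvelopeIter n).IsClosedUnderBinaryProducts := by
  have := isClosedUnderLimitsOfShape_retractClosure
    (P.shiftClosure ℤ).binaryProductsClosure WalkingPair
  have := isClosedUnderLimitsOfShape_extensionProductIter
    (P.shiftClosure ℤ).binaryProductsClosure.retractClosure WalkingPair n
  exact isClosedUnderLimitsOfShape_retractClosure _ WalkingPair

lemma triangEnvelopeIter_biprod (n : ℕ) {X Y : C} (hX : P.triangEnvelopeIter n X)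
    (hY : P.triangEnvelopeIter n Y) : P.triangEnvelopeIter n (X ⊞ Y) :=
  prop_of_isLimit_binaryFan _ (BinaryBiproduct.isLimit X Y) hX hY

/-- If the identity of `X` is the sum of two morphisms factoring through `Y` and `Z`, then `X`
is a direct summand of `Y ⊞ Z`. -/
lemma triangEnvelopeIter_of_add_eq_id (n : ℕ) {X Y Z : C} (hY : P.triangEnvelopeIter n Y)
    (hZ : P.triangEnvelopeIter n Z) {p : X ⟶ Y} {i : Y ⟶ X} {q : X ⟶ Z} {j : Z ⟶ X}
    (h : p ≫ i + q ≫ j = 𝟙 X) : P.triangEnvelopeIter n X :=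
  prop_of_retract _ ⟨biprod.lift p q, biprod.desc i j, by rw [biprod.lift_desc, h]⟩
    (P.triangEnvelopeIter_biprod n hY hZ)

/-- Associativity of extensions, hence the octahedral axiom, lets `n + 1` layers be stacked on `n +
1` layers; the index counts layers minus one. -/
lemma triangEnvelopeIter_extension [IsTriangulated C] (n : ℕ) {X Y Z : C} {f : Y ⟶ X} {g : X ⟶ Z}
    {h : Z ⟶ Y⟦(1 : ℤ)⟧} (hT : Triangle.mk f g h ∈ distTriang C)
    (hY : P.triangEnvelopeIter n Y) (hZ : P.triangEnvelopeIter n Z) :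
    P.triangEnvelopeIter (n + n + 1) X := by
  rw [Nat.add_right_comm, P.triangEnvelopeIter_add rfl]
  exact le_retractClosure _ _ ⟨_, _, _, _, _, hT, hY, hZ⟩

variable {P}

section

variable {D : Type u₁} [Category.{v₁} D] [HasZeroObject D] [HasShift D ℤ]
  [Preadditive D] [∀ n : ℤ, (shiftFunctor D n).Additive] [Pretriangulated D]
  (F : C ⥤ D) [F.CommShift ℤ] [F.IsTriangulated] {Q : ObjectProperty D}

lemma triangEnvelopeIter_zero_map (h : ∀ X, P X → Q.triangEnvelopeIter 0 (F.obj X)) {X : C}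
    (hX : P.triangEnvelopeIter 0 X) : Q.triangEnvelopeIter 0 (F.obj X) := by
  rw [triangEnvelopeIter_zero] at hX
  obtain ⟨Y, hY, ⟨r⟩⟩ := hX
  refine prop_of_retract _ (r.map F) ?_
  clear r
  induction hY with
  | of_mem Y hY =>
    obtain ⟨Z, n, e, hZ⟩ := hY
    exact prop_of_iso _ (F.mapIso e ≪≫ (F.commShiftIso n).app Z).symm
      (le_shift _ n _ (h Z hZ))
  | of_isoClosure e _ ih => exact prop_of_iso _ (F.mapIso e) ih
  | of_limitPresentation pres _ ih => exact prop_of_isLimit _ (pres.map F).isLimit ih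

lemma triangEnvelopeIter_map (h : ∀ X, P X → Q.triangEnvelopeIter 0 (F.obj X)) {n : ℕ} {X : C}
    (hX : P.triangEnvelopeIter n X) : Q.triangEnvelopeIter n (F.obj X) := by
  induction n generalizing X with
  | zero => exact triangEnvelopeIter_zero_map F h hX
  | succ n ih =>
    rw [triangEnvelopeIter_succ, ← triangEnvelopeIter_zero] at hX ⊢
    obtain ⟨Y, ⟨U, V, f, g, k, hT, hU, hV⟩, ⟨r⟩⟩ := hX
    exact ⟨F.obj Y, ⟨F.obj U, F.obj V, _, _, _, F.map_distinguished _ hT,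
      triangEnvelopeIter_zero_map F h hU, ih hV⟩, ⟨r.map F⟩⟩

end

end

end CategoryTheory.ObjectProperty

/-! ### The Rouquier dimension of triangulated categories -/

section Rouquier

open Pretriangulated

variable {T : Type u} [Category.{v} T] [HasZeroObject T] [HasShift T ℤ] [Preadditive T]
  [∀ n : ℤ, (shiftFunctor T n).Additive] [Pretriangulated T]
  {T₁ : Type u₁} [Category.{v₁} T₁] [HasZeroObject T₁] [HasShift T₁ ℤ] [Preadditive T₁]
  [∀ n : ℤ, (shiftFunctor T₁ n).Additive] [Pretriangulated T₁]
  {T₂ : Type u₂} [Category.{v₂} T₂] [HasZeroObject T₂] [HasShift T₂ ℤ] [Preadditive T₂]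
  [∀ n : ℤ, (shiftFunctor T₂ n).Additive] [Pretriangulated T₂]

lemma rouquierDimension_le_iff (m : ℕ) : rouquierDimension T ≤ m ↔
    ∃ X : T, ∀ Y : T, (ObjectProperty.singleton X).triangEnvelopeIter m Y := by
  refine (iInf_natCast_le_iff _ _).trans ⟨?_, fun h => ⟨m, h, le_rfl⟩⟩
  rintro ⟨k, ⟨X, hX⟩, hk⟩
  exact ⟨X, fun Y => ObjectProperty.monotone'_triangEnvelopeIter _ hk _ (hX Y)⟩

lemma triangEnvelopeIter_singleton_map (F : T₁ ⥤ T) [F.CommShift ℤ] [F.IsTriangulated] {X : T₁}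
    {X' : T} (r : Retract (F.obj X) X') {m : ℕ} {Y : T₁}
    (hY : (ObjectProperty.singleton X).triangEnvelopeIter m Y) :
    (ObjectProperty.singleton X').triangEnvelopeIter m (F.obj Y) :=
  ObjectProperty.triangEnvelopeIter_map F (fun Z hZ => by
    obtain rfl := (ObjectProperty.singleton_iff _ _).1 hZ
    exact ObjectProperty.prop_of_retract _ r
      (ObjectProperty.le_triangEnvelopeIter _ 0 _ (by simp))) hY

lemma rouquierDimension_le_of_essSurj (F : T ⥤ T₁) [F.CommShift ℤ] [F.IsTriangulated]
    [F.EssSurj] : rouquierDimension T₁ ≤ rouquierDimension T := by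
  refine le_iInf₂ fun m hm => ?_
  obtain ⟨X, hX⟩ := hm
  exact iInf₂_le m ⟨F.obj X, fun Y => ObjectProperty.prop_of_iso _ (F.objObjPreimageIso Y)
    (triangEnvelopeIter_singleton_map F (.refl _) (hX (F.objPreimage Y)))⟩

/-- The object `X` is a direct summand of `Y ⊞ Z`. -/
def IsRetractOfSum (X Y Z : T) : Prop :=
  ∃ (p : X ⟶ Y) (i : Y ⟶ X) (q : X ⟶ Z) (j : Z ⟶ X), p ≫ i + q ≫ j = 𝟙 X

lemma rouquierDimension_le_of_distinguished [IsTriangulated T]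
    (F₁ : T₁ ⥤ T) [F₁.CommShift ℤ] [F₁.IsTriangulated]
    (F₂ : T₂ ⥤ T) [F₂.CommShift ℤ] [F₂.IsTriangulated]
    (h : ∀ X : T, ∃ (X' Y Z : T) (f : Y ⟶ X') (g : X' ⟶ Z) (k : Z ⟶ Y⟦(1 : ℤ)⟧),
      Nonempty (X ≅ X') ∧ Triangle.mk f g k ∈ distTriang T ∧
        (∃ U₁ U₂, IsRetractOfSum Y (F₁.obj U₁) (F₂.obj U₂)) ∧
          ∃ V₁ V₂, IsRetractOfSum Z (F₁.obj V₁) (F₂.obj V₂)) :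
    rouquierDimension T ≤ 2 * max (rouquierDimension T₁) (rouquierDimension T₂) + 1 := by
  refine ENat.le_two_mul_max_add_one fun m h₁ h₂ => ?_
  rw [rouquierDimension_le_iff] at h₁ h₂ ⊢
  obtain ⟨X₁, hX₁⟩ := h₁
  obtain ⟨X₂, hX₂⟩ := h₂
  have key {Y : T} {U₁ : T₁} {U₂ : T₂} (hY : IsRetractOfSum Y (F₁.obj U₁) (F₂.obj U₂)) :
      (ObjectProperty.singleton (F₁.obj X₁ ⊞ F₂.obj X₂)).triangEnvelopeIter m Y := by
    obtain ⟨p, i, q, j, hpq⟩ := hY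
    exact ObjectProperty.triangEnvelopeIter_of_add_eq_id _ m
      (triangEnvelopeIter_singleton_map F₁ ⟨biprod.inl, biprod.fst, by simp⟩ (hX₁ U₁))
      (triangEnvelopeIter_singleton_map F₂ ⟨biprod.inr, biprod.snd, by simp⟩ (hX₂ U₂)) hpq
  refine ⟨F₁.obj X₁ ⊞ F₂.obj X₂, fun X => ?_⟩
  obtain ⟨X', Y, Z, f, g, k, ⟨e⟩, hT, ⟨U₁, U₂, hU⟩, V₁, V₂, hV⟩ := h X
  exact ObjectProperty.prop_of_iso _ e.symm
    (ObjectProperty.triangEnvelopeIter_extension _ m hT (key hU) (key hV))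

end Rouquier


/-! ### Bounded derived categories and functors induced by exact functors -/

section Derived

open Pretriangulated DerivedCategory

variable {C : Type u} [Category.{v} C] [Abelian C] [HasDerivedCategory.{w} C]
  {D : Type u₁} [Category.{v₁} D] [Abelian D] [HasDerivedCategory.{w₁} D]

lemma bounded_Q_obj (K : CochainComplex C ℤ) (a b : ℤ) [K.IsStrictlyGE a] [K.IsStrictlyLE b] :
    (TStructure.t : Triangulated.TStructure (DerivedCategory C)).bounded (Q.obj K) :=
  ⟨⟨a, inferInstance⟩, ⟨b, inferInstance⟩⟩

lemma exists_iso_Q_obj_of_bounded (X : DerivedCategory C)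
    (hX : (TStructure.t : Triangulated.TStructure (DerivedCategory C)).bounded X) :
    ∃ (K : CochainComplex C ℤ) (a b : ℤ), K.IsStrictlyGE a ∧ K.IsStrictlyLE b ∧
      Nonempty (X ≅ Q.obj K) := by
  obtain ⟨⟨a, ha⟩, ⟨b, hb⟩⟩ := hX
  have : X.IsGE a := ha
  have : X.IsLE b := hb
  obtain ⟨K, hK, hK', e⟩ := X.exists_iso_Q_obj_of_isGE_of_isLE a b
  exact ⟨K, a, b, hK, hK', e⟩

omit [HasDerivedCategory C] [HasDerivedCategory D] in
lemma isStrictlyGE_mapHomologicalComplex (F : C ⥤ D) [F.Additive] (K : CochainComplex C ℤ) (a : ℤ)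
    [K.IsStrictlyGE a] :
    CochainComplex.IsStrictlyGE ((F.mapHomologicalComplex (ComplexShape.up ℤ)).obj K) a := by
  rw [CochainComplex.isStrictlyGE_iff]
  exact fun i hi => F.map_isZero (K.isZero_of_isStrictlyGE a i hi)

omit [HasDerivedCategory C] [HasDerivedCategory D] in
lemma isStrictlyLE_mapHomologicalComplex (F : C ⥤ D) [F.Additive] (K : CochainComplex C ℤ) (a : ℤ)
    [K.IsStrictlyLE a] :
    CochainComplex.IsStrictlyLE ((F.mapHomologicalComplex (ComplexShape.up ℤ)).obj K) a := by
  rw [CochainComplex.isStrictlyLE_iff]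
  exact fun i hi => F.map_isZero (K.isZero_of_isStrictlyLE a i hi)

omit [HasDerivedCategory C] in
lemma bounded_Q_obj_mapHomologicalComplex (F : C ⥤ D) [F.Additive] (K : CochainComplex C ℤ)
    (a b : ℤ) [K.IsStrictlyGE a] [K.IsStrictlyLE b] :
    (TStructure.t : Triangulated.TStructure (DerivedCategory D)).bounded
      (Q.obj ((F.mapHomologicalComplex (ComplexShape.up ℤ)).obj K)) :=
  have := isStrictlyGE_mapHomologicalComplex F K a
  have := isStrictlyLE_mapHomologicalComplex F K b
  bounded_Q_obj _ a b

variable (F : C ⥤ D) [F.Additive] [PreservesFiniteLimits F] [PreservesFiniteColimits F]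

lemma bounded_mapDerivedCategory_obj (X : DerivedCategory.Bounded C) :
    (TStructure.t : Triangulated.TStructure (DerivedCategory D)).bounded
      ((Bounded.ι ⋙ F.mapDerivedCategory).obj X) := by
  obtain ⟨K, a, b, _, _, ⟨e⟩⟩ := exists_iso_Q_obj_of_bounded X.obj X.property
  exact ObjectProperty.prop_of_iso _
    (F.mapDerivedCategory.mapIso e ≪≫ F.mapDerivedCategoryFactors.app K).symm
    (bounded_Q_obj_mapHomologicalComplex F K a b)

/-- The functor between bounded derived categories induced by an exact functor. -/
def CategoryTheory.Functor.mapBoundedDerivedCategory :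
    DerivedCategory.Bounded C ⥤ DerivedCategory.Bounded D :=
  ObjectProperty.lift _ (Bounded.ι ⋙ F.mapDerivedCategory) (bounded_mapDerivedCategory_obj F)

instance : F.mapBoundedDerivedCategory.CommShift ℤ := by
  dsimp only [Functor.mapBoundedDerivedCategory]
  infer_instance

instance : F.mapBoundedDerivedCategory.IsTriangulated := by
  dsimp only [Functor.mapBoundedDerivedCategory]
  infer_instance

/-- The value of the functor induced by an exact functor on a bounded complex. -/
def mapBoundedDerivedCategoryObjIso (K : CochainComplex C ℤ) {X : DerivedCategory.Bounded C}
    (e : X.obj ≅ Q.obj K) {Y : DerivedCategory.Bounded D}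
    (e' : Y.obj ≅ Q.obj ((F.mapHomologicalComplex (ComplexShape.up ℤ)).obj K)) :
    F.mapBoundedDerivedCategory.obj X ≅ Y :=
  ObjectProperty.isoMk _
    (F.mapDerivedCategory.mapIso e ≪≫ F.mapDerivedCategoryFactors.app K ≪≫ e'.symm)

/-- A functor with an additive right inverse induces an essentially surjective functor on bounded
derived categories. -/
lemma mapBoundedDerivedCategory_essSurj (Z : D ⥤ C) [Z.Additive] (e : Z ⋙ F ≅ 𝟭 D) :
    F.mapBoundedDerivedCategory.EssSurj where
  mem_essImage X := by
    -- The section `Z` is only assumed additive, so it is applied termwise to a bounded complex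
    -- representing `X`.
    obtain ⟨K, a, b, _, _, ⟨f⟩⟩ := exists_iso_Q_obj_of_bounded X.obj X.property
    refine ⟨⟨_, bounded_Q_obj_mapHomologicalComplex Z K a b⟩,
      ⟨mapBoundedDerivedCategoryObjIso F _ (Iso.refl _) (f ≪≫ (Q.mapIso ?_).symm)⟩⟩
    exact (NatIso.mapHomologicalComplex e _).app K ≪≫
      (Functor.mapHomologicalComplexIdIso D (ComplexShape.up ℤ)).app K

end Derived

/-! ### Two-step filtrations -/

section TwoStepFiltration

variable {C : Type u} [Category.{v} C] {D : Type u₁} [Category.{v₁} D]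
  {E : Type u₂} [Category.{v₂} E] [Preadditive C] [Preadditive D] [Abelian E]

/-- A natural decomposition of a functor into a sum of functors factoring through `Z₁` and `Z₂`. -/
structure SumDecomposition (F : E ⥤ E) (Z₁ : C ⥤ E) (Z₂ : D ⥤ E) where
  /-- the first functor -/
  left : E ⥤ C
  /-- the second functor -/
  right : E ⥤ D
  left_additive : left.Additive
  right_additive : right.Additive
  /-- the first projection -/
  fst : F ⟶ left ⋙ Z₁
  /-- the first inclusion -/
  inl : left ⋙ Z₁ ⟶ F
  /-- the second projection -/
  snd : F ⟶ right ⋙ Z₂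
  /-- the second inclusion -/
  inr : right ⋙ Z₂ ⟶ F
  inl_fst (X : E) : inl.app X ≫ fst.app X = 𝟙 _
  inr_snd (X : E) : inr.app X ≫ snd.app X = 𝟙 _
  total (X : E) : fst.app X ≫ inl.app X + snd.app X ≫ inr.app X = 𝟙 (F.obj X)

attribute [instance] SumDecomposition.left_additive SumDecomposition.right_additive

/-- A functorial filtration of the objects of `E`, whose two subquotients are sums of objects coming
from `C` and `D`. -/
structure TwoStepFiltration (Z₁ : C ⥤ E) (Z₂ : D ⥤ E) where
  /-- the subobject -/
  sub : E ⥤ E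
  /-- the quotient -/
  quot : E ⥤ E
  sub_additive : sub.Additive
  quot_additive : quot.Additive
  /-- the inclusion of the subobject -/
  ι : sub ⟶ 𝟭 E
  /-- the projection onto the quotient -/
  π : 𝟭 E ⟶ quot
  w (X : E) : ι.app X ≫ π.app X = 0
  shortExact (X : E) : (ShortComplex.mk (ι.app X) (π.app X) (w X)).ShortExact
  /-- the decomposition of the subobject -/
  subDecomposition : SumDecomposition sub Z₁ Z₂
  /-- the decomposition of the quotient -/
  quotDecomposition : SumDecomposition quot Z₁ Z₂

attribute [instance] TwoStepFiltration.sub_additive TwoStepFiltration.quot_additive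

variable {Z₁ : C ⥤ E} {Z₂ : D ⥤ E}

/-- The decomposition of a value of a decomposed functor as a biproduct. -/
def SumDecomposition.iso {F : E ⥤ E} (d : SumDecomposition F Z₁ Z₂) (X : E) :
    F.obj X ≅ Z₁.obj (d.left.obj X) ⊞ Z₂.obj (d.right.obj X) where
  hom := biprod.lift (d.fst.app X) (d.snd.app X)
  inv := biprod.desc (d.inl.app X) (d.inr.app X)
  hom_inv_id := by rw [biprod.lift_desc, d.total]
  inv_hom_id := by
    have h₁ : d.inl.app X ≫ d.snd.app X = 0 := by
      have := d.inl.app X ≫= d.total X =≫ d.snd.app X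
      rw [Preadditive.add_comp, Preadditive.comp_add, Category.assoc, Category.assoc, d.inr_snd,
        reassoc_of% d.inl_fst X] at this
      simpa using this
    have h₂ : d.inr.app X ≫ d.fst.app X = 0 := by
      have := d.inr.app X ≫= d.total X =≫ d.fst.app X
      rw [Preadditive.add_comp, Preadditive.comp_add, Category.assoc, Category.assoc, d.inl_fst,
        reassoc_of% d.inr_snd X] at this
      simpa using this
    have h₃ := d.inl_fst X
    have h₄ := d.inr_snd X
    dsimp at h₁ h₂ h₃ h₄
    ext <;> simp [h₁, h₂, h₃, h₄]

lemma TwoStepFiltration.exists_shortExact (t : TwoStepFiltration Z₁ Z₂) (X : E) :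
    ∃ (U₁ V₁ : C) (U₂ V₂ : D) (i : Z₁.obj U₁ ⊞ Z₂.obj U₂ ⟶ X)
      (p : X ⟶ Z₁.obj V₁ ⊞ Z₂.obj V₂) (w : i ≫ p = 0), (ShortComplex.mk i p w).ShortExact :=
  ⟨_, _, _, _, _, _, _, shortExact_of_iso_right (shortExact_of_iso_left (t.shortExact X)
    (t.subDecomposition.iso X).symm) (t.quotDecomposition.iso X)⟩

end TwoStepFiltration


/-! ### Two-step filtrations of bounded complexes -/

section

open Pretriangulated DerivedCategory

variable {C : Type u} [Category.{v} C] [Abelian C]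
  {D : Type u₁} [Category.{v₁} D] [Abelian D]
  {E : Type u₂} [Category.{v₂} E] [Abelian E]
  {Z₁ : C ⥤ E} [Z₁.Additive] {Z₂ : D ⥤ E} [Z₂.Additive]

namespace TwoStepFiltration

/-- The short exact sequence of complexes given by a functorial filtration. -/
@[simps]
def shortComplex (t : TwoStepFiltration Z₁ Z₂) (K : CochainComplex E ℤ) :
    ShortComplex (CochainComplex E ℤ) where
  X₁ := (t.sub.mapHomologicalComplex (ComplexShape.up ℤ)).obj K
  X₂ := K
  X₃ := (t.quot.mapHomologicalComplex (ComplexShape.up ℤ)).obj K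
  f := { f := fun i => t.ι.app (K.X i)
         comm' := fun i j _ => (t.ι.naturality (K.d i j)).symm }
  g := { f := fun i => t.π.app (K.X i)
         comm' := fun i j _ => (t.π.naturality (K.d i j)).symm }
  zero := by
    ext i
    exact t.w (K.X i)

omit [Z₁.Additive] [Z₂.Additive] in
lemma shortComplex_shortExact (t : TwoStepFiltration Z₁ Z₂) (K : CochainComplex E ℤ) :
    (t.shortComplex K).ShortExact :=
  HomologicalComplex.shortExact_of_degreewise_shortExact _ fun i => t.shortExact (K.X i)

end TwoStepFiltration

variable [HasDerivedCategory.{w} C] [HasDerivedCategory.{w₁} D] [HasDerivedCategory.{w₂} E]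
  [PreservesFiniteLimits Z₁] [PreservesFiniteColimits Z₁]
  [PreservesFiniteLimits Z₂] [PreservesFiniteColimits Z₂]

/-- Naturality makes the splitting a splitting of complexes. The functors `left` and `right` need
not be exact: they are applied to the chosen complex, and only `Z₁` and `Z₂` act on derived
categories. -/
lemma SumDecomposition.isRetractOfSum {F : E ⥤ E} [F.Additive] (d : SumDecomposition F Z₁ Z₂)
    (K : CochainComplex E ℤ) (a b : ℤ) [K.IsStrictlyGE a] [K.IsStrictlyLE b] :
    ∃ U₁ U₂, IsRetractOfSum
      (⟨_, bounded_Q_obj_mapHomologicalComplex F K a b⟩ : DerivedCategory.Bounded E)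
      (Z₁.mapBoundedDerivedCategory.obj U₁) (Z₂.mapBoundedDerivedCategory.obj U₂) := by
  let L₁ := (d.left.mapHomologicalComplex (ComplexShape.up ℤ)).obj K
  let L₂ := (d.right.mapHomologicalComplex (ComplexShape.up ℤ)).obj K
  have := isStrictlyGE_mapHomologicalComplex d.left K a
  have := isStrictlyLE_mapHomologicalComplex d.left K b
  have := isStrictlyGE_mapHomologicalComplex d.right K a
  have := isStrictlyLE_mapHomologicalComplex d.right K b
  let Y₁ : DerivedCategory.Bounded E := ⟨_, bounded_Q_obj_mapHomologicalComplex Z₁ L₁ a b⟩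
  let Y₂ : DerivedCategory.Bounded E := ⟨_, bounded_Q_obj_mapHomologicalComplex Z₂ L₂ a b⟩
  let e₁ : Z₁.mapBoundedDerivedCategory.obj ⟨_, bounded_Q_obj L₁ a b⟩ ≅ Y₁ :=
    mapBoundedDerivedCategoryObjIso Z₁ L₁ (Iso.refl _) (Iso.refl _)
  let e₂ : Z₂.mapBoundedDerivedCategory.obj ⟨_, bounded_Q_obj L₂ a b⟩ ≅ Y₂ :=
    mapBoundedDerivedCategoryObjIso Z₂ L₂ (Iso.refl _) (Iso.refl _)
  let p : (⟨_, bounded_Q_obj_mapHomologicalComplex F K a b⟩ : DerivedCategory.Bounded E) ⟶ Y₁ :=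
    ObjectProperty.homMk (Q.map ((NatTrans.mapHomologicalComplex d.fst _).app K))
  let i : Y₁ ⟶ (⟨_, bounded_Q_obj_mapHomologicalComplex F K a b⟩ : DerivedCategory.Bounded E) :=
    ObjectProperty.homMk (Q.map ((NatTrans.mapHomologicalComplex d.inl _).app K))
  let q : (⟨_, bounded_Q_obj_mapHomologicalComplex F K a b⟩ : DerivedCategory.Bounded E) ⟶ Y₂ :=
    ObjectProperty.homMk (Q.map ((NatTrans.mapHomologicalComplex d.snd _).app K))
  let j : Y₂ ⟶ (⟨_, bounded_Q_obj_mapHomologicalComplex F K a b⟩ : DerivedCategory.Bounded E) :=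
    ObjectProperty.homMk (Q.map ((NatTrans.mapHomologicalComplex d.inr _).app K))
  refine ⟨_, _, p ≫ e₁.inv, e₁.hom ≫ i, q ≫ e₂.inv, e₂.hom ≫ j, ?_⟩
  simp only [Category.assoc, Iso.inv_hom_id_assoc]
  have key : (NatTrans.mapHomologicalComplex d.fst (ComplexShape.up ℤ)).app K ≫
      (NatTrans.mapHomologicalComplex d.inl (ComplexShape.up ℤ)).app K +
      (NatTrans.mapHomologicalComplex d.snd (ComplexShape.up ℤ)).app K ≫
      (NatTrans.mapHomologicalComplex d.inr (ComplexShape.up ℤ)).app K = 𝟙 _ := by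
    ext n
    exact d.total (K.X n)
  apply ObjectProperty.hom_ext
  have := congr(Q.map $key)
  rw [Q.map_add, Q.map_comp, Q.map_comp, Q.map_id] at this
  exact this

lemma rouquierDimension_bounded_le (t : TwoStepFiltration Z₁ Z₂) :
    rouquierDimension (DerivedCategory.Bounded E) ≤
      2 * max (rouquierDimension (DerivedCategory.Bounded C))
        (rouquierDimension (DerivedCategory.Bounded D)) + 1 := by
  refine rouquierDimension_le_of_distinguished Z₁.mapBoundedDerivedCategory
    Z₂.mapBoundedDerivedCategory fun X => ?_
  obtain ⟨K, a, b, _, _, ⟨e⟩⟩ := exists_iso_Q_obj_of_bounded X.obj X.property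
  have hT := triangleOfSES_distinguished (t.shortComplex_shortExact K)
  refine ⟨⟨Q.obj K, bounded_Q_obj K a b⟩, ⟨_, bounded_Q_obj_mapHomologicalComplex t.sub K a b⟩,
    ⟨_, bounded_Q_obj_mapHomologicalComplex t.quot K a b⟩,
    ObjectProperty.homMk (triangleOfSES (t.shortComplex_shortExact K)).mor₁,
    ObjectProperty.homMk (triangleOfSES (t.shortComplex_shortExact K)).mor₂,
    ObjectProperty.homMk ((triangleOfSES (t.shortComplex_shortExact K)).mor₃ ≫
      (Bounded.ι.commShiftIso (1 : ℤ)).inv.app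
        ⟨_, bounded_Q_obj_mapHomologicalComplex t.sub K a b⟩),
    ⟨ObjectProperty.isoMk _ e⟩, ?_, t.subDecomposition.isRetractOfSum K a b,
    t.quotDecomposition.isRetractOfSum K a b⟩
  -- The triangle is that of a short exact sequence of complexes; only its last map is rewritten, by
  -- comparing the shift of the bounded subcategory with the ambient one.
  refine isomorphic_distinguished _ hT _ ?_
  refine Triangle.isoMk _ _ (Iso.refl _) (Iso.refl _) (Iso.refl _) ?_ ?_ ?_
  · exact (Category.comp_id _).trans (Category.id_comp _).symm
  · exact (Category.comp_id _).trans (Category.id_comp _).symm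
  · refine (congrArg (_ ≫ ·) ((shiftFunctor (DerivedCategory E) (1 : ℤ)).map_id _)).trans ?_
    refine (Category.comp_id _).trans (Eq.trans ?_ (Category.id_comp _).symm)
    refine (Category.assoc _ _ _).trans ?_
    refine (congrArg ((triangleOfSES (t.shortComplex_shortExact K)).mor₃ ≫ ·)
      (Iso.inv_hom_id_app ((Bounded.ι (C := E)).commShiftIso (1 : ℤ))
        ⟨_, bounded_Q_obj_mapHomologicalComplex t.sub K a b⟩)).trans ?_
    exact Category.comp_id _

end


/-! ### Exactness and projectivity for finitely generated modules -/

namespace FGModuleCat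

variable {R : Type u} [Ring R] [IsNoetherianRing R]

lemma exact_iff (S : ShortComplex (FGModuleCat.{u} R)) :
    S.Exact ↔ Function.Exact S.f.hom.hom S.g.hom.hom := by
  rw [← S.exact_map_iff_of_faithful (forget₂ (FGModuleCat.{u} R) (ModuleCat.{u} R)),
    CategoryTheory.ShortComplex.ShortExact.moduleCat_exact_iff_function_exact]
  rfl

lemma mono_of_injective {X Y : FGModuleCat.{u} R} (f : X ⟶ Y)
    (h : Function.Injective f.hom.hom) : Mono f :=
  (forget₂ (FGModuleCat.{u} R) (ModuleCat.{u} R)).mono_of_mono_map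
    ((ModuleCat.mono_iff_injective _).2 h)

lemma epi_iff_surjective {X Y : FGModuleCat.{u} R} (f : X ⟶ Y) :
    Epi f ↔ Function.Surjective f.hom.hom := by
  rw [← ModuleCat.epi_iff_surjective]
  exact ((forget₂ (FGModuleCat.{u} R) (ModuleCat.{u} R)).epi_map_iff_epi f).symm

lemma shortExact_of_function {X Y Z : FGModuleCat.{u} R} (f : X ⟶ Y) (g : Y ⟶ Z) (w : f ≫ g = 0)
    (hf : Function.Injective f.hom.hom) (hfg : Function.Exact f.hom.hom g.hom.hom)
    (hg : Function.Surjective g.hom.hom) : (ShortComplex.mk f g w).ShortExact where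
  exact := (exact_iff _).2 hfg
  mono_f := mono_of_injective f hf
  epi_g := (epi_iff_surjective g).2 hg

lemma projective_of_module (X : FGModuleCat.{u} R) (h : Module.Projective R X) : Projective X where
  factors {E Y} f e he := by
    obtain ⟨g, hg⟩ := Module.projective_lifting_property e.hom.hom f.hom.hom
      ((epi_iff_surjective e).1 he)
    exact ⟨ObjectProperty.homMk (ModuleCat.ofHom g), hom_ext hg⟩

attribute [local instance] Abelian.hasFiniteBiproducts in
variable (R) in
lemma isFiniteProjectiveGenerator : IsFiniteProjectiveGenerator (FGModuleCat.of R R) := by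
  intro X
  obtain ⟨k, f, hf⟩ := Module.Finite.exists_fin' R X
  refine ⟨FGModuleCat.of R (Fin k → R), ObjectProperty.homMk (ModuleCat.ofHom f),
    projective_of_module _ (inferInstanceAs (Module.Projective R (Fin k → R))), ?_,
    (epi_iff_surjective _).2 hf⟩
  refine ⟨k, fun _ => FGModuleCat.of R R, fun _ => by simp, ⟨⟨biproduct.lift fun i =>
    ObjectProperty.homMk (ModuleCat.ofHom (LinearMap.proj i)), biproduct.desc fun i =>
    ObjectProperty.homMk (ModuleCat.ofHom (LinearMap.single R (fun _ => R) i)), ?_⟩⟩⟩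
  rw [biproduct.lift_desc]
  apply (ModuleCat.isFG R).ι.map_injective
  rw [Functor.map_sum]
  ext x
  simpa [ModuleCat.hom_sum, LinearMap.sum_apply] using Finset.univ_sum_single x

lemma exact_of_map_shortExact {S : Type u} [Ring S] [IsNoetherianRing S]
    (F : FGModuleCat.{u} R ⥤ FGModuleCat.{u} S) [F.Additive]
    (hF : ∀ (T : ShortComplex (FGModuleCat.{u} R)), Function.Exact T.f.hom.hom T.g.hom.hom →
      Function.Exact (F.map T.f).hom.hom (F.map T.g).hom.hom) :
    PreservesFiniteLimits F ∧ PreservesFiniteColimits F :=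
  ((Functor.exact_tfae F).out 1 3).1 fun T hT => (exact_iff _).2 (hF T ((exact_iff T).1 hT))

end FGModuleCat

lemma FGModuleCat.projective_iff_module {R : Type u} [Ring R] [IsNoetherianRing R]
    (X : FGModuleCat.{u} R) : Projective X ↔ Module.Projective R X := by
  refine ⟨fun h => ?_, projective_of_module X⟩
  obtain ⟨k, f, hf⟩ := Module.Finite.exists_fin' R X
  let p : FGModuleCat.of R (Fin k → R) ⟶ X := ObjectProperty.homMk (ModuleCat.ofHom f)
  have : Epi p := (epi_iff_surjective _).2 hf
  have : Module.Projective R (Fin k → R) := inferInstance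
  exact Module.Projective.of_split (Projective.factorThru (𝟙 X) p).hom.hom f
    congr(($(Projective.factorThru_comp (𝟙 X) p)).hom.hom)

/-! ### Rings that are at once a quotient and a corner -/

/-- A ring `S` which is both a quotient of `R` and a corner `e R e` of `R`, in a compatible way. -/
structure CornerProjection (R S : Type u) [Ring R] [Ring S] where
  /-- the projection -/
  proj : R →+* S
  /-- the inclusion of the corner -/
  incl : S →ₙ+* R
  proj_incl (s : S) : proj (incl s) = s
  incl_one_mul_mul (r : R) : incl 1 * r * incl 1 = incl (proj r)

namespace CornerProjection

variable {R S : Type u} [Ring R] [Ring S] (c : CornerProjection R S)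

lemma proj_surjective : Function.Surjective c.proj := fun s => ⟨_, c.proj_incl s⟩

/-- The idempotent of a corner. -/
def e : R := c.incl 1

@[simp] lemma e_mul_incl (s : S) : c.e * c.incl s = c.incl s := by
  rw [e, ← map_mul, one_mul]

@[simp] lemma incl_mul_e (s : S) : c.incl s * c.e = c.incl s := by
  rw [e, ← map_mul, mul_one]

@[simp] lemma e_mul_e : c.e * c.e = c.e := c.e_mul_incl 1

@[simp] lemma proj_e : c.proj c.e = 1 := c.proj_incl 1

lemma e_mul_mul_e (r : R) : c.e * r * c.e = c.incl (c.proj r) := c.incl_one_mul_mul r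

/-! ### Inflation -/

/-- Inflation of finitely generated modules along the projection. -/
def inflation : FGModuleCat.{u} S ⥤ FGModuleCat.{u} R :=
  ObjectProperty.lift _ ((ModuleCat.isFG S).ι ⋙ ModuleCat.restrictScalars c.proj) fun X => by
    let _ : Module R S := Module.compHom S c.proj
    let _ : Module R X := Module.compHom X c.proj
    have : Module.Finite R S := Module.Finite.of_surjective
      ({ toFun := c.proj
         map_add' := map_add _
         map_smul' := map_mul _ } : R →ₗ[R] S) c.proj_surjective
    have : IsScalarTower R S X := ⟨fun r s x => mul_smul (c.proj r) s x⟩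
    exact (Module.Finite.trans S X : Module.Finite R X)

instance : c.inflation.Additive where

instance [IsNoetherianRing R] [IsNoetherianRing S] : PreservesFiniteLimits c.inflation :=
  (FGModuleCat.exact_of_map_shortExact c.inflation fun _ h => h).1

instance [IsNoetherianRing R] [IsNoetherianRing S] : PreservesFiniteColimits c.inflation :=
  (FGModuleCat.exact_of_map_shortExact c.inflation fun _ h => h).2

/-! ### Corners of modules -/

section

variable (X : Type u) [AddCommGroup X] [Module R X]

/-- The part `e X` of an `R`-module `X`. -/
def corner : AddSubgroup X where
  carrier := {x | c.e • x = x}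
  zero_mem' := smul_zero _
  add_mem' {x y} hx hy := by
    rw [Set.mem_ofPred_eq] at *
    rw [smul_add, hx, hy]
  neg_mem' {x} hx := by
    rw [Set.mem_ofPred_eq] at *
    rw [smul_neg, hx]

variable {X}

lemma mem_corner {x : X} : x ∈ c.corner X ↔ c.e • x = x := Iff.rfl

@[simp] lemma e_smul_coe (x : c.corner X) : c.e • (x : X) = x := x.2

lemma incl_smul_mem (s : S) (x : X) : c.incl s • x ∈ c.corner X := by
  rw [mem_corner, smul_smul, e_mul_incl]

lemma e_smul_mem (x : X) : c.e • x ∈ c.corner X := c.incl_smul_mem 1 x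

instance : Module S (c.corner X) where
  smul s x := ⟨c.incl s • (x : X), c.incl_smul_mem s _⟩
  one_smul x := Subtype.ext x.2
  mul_smul s t x := Subtype.ext (by
    change c.incl (s * t) • (x : X) = c.incl s • c.incl t • (x : X)
    rw [map_mul, mul_smul])
  smul_zero s := Subtype.ext (smul_zero _)
  smul_add s x y := Subtype.ext (smul_add _ _ _)
  add_smul s t x := Subtype.ext (by
    change c.incl (s + t) • (x : X) = c.incl s • (x : X) + c.incl t • (x : X)
    rw [map_add, add_smul])
  zero_smul x := Subtype.ext (by
    change c.incl 0 • (x : X) = 0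
    rw [map_zero, zero_smul])

@[simp] lemma coe_smul (s : S) (x : c.corner X) : ((s • x : c.corner X) : X) = c.incl s • (x : X) :=
  rfl

variable {Y : Type u} [AddCommGroup Y] [Module R Y]

/-- The linear map of corners induced by a linear map. -/
def cornerMap (f : X →ₗ[R] Y) : c.corner X →ₗ[S] c.corner Y where
  toFun x := ⟨f x, by rw [mem_corner, ← map_smul, e_smul_coe]⟩
  map_add' x y := Subtype.ext (map_add f _ _)
  map_smul' s x := Subtype.ext (map_smul f _ _)

@[simp] lemma coe_cornerMap (f : X →ₗ[R] Y) (x : c.corner X) : (c.cornerMap f x : Y) = f x := rfl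

end

/-- The base ring `R₀` maps to the center of `R`, so `e X` is an `R₀`-submodule of a finite module
over a Noetherian ring. It is finite over `R₀`, and therefore over `S`. -/
lemma finite_corner [h : IsNoetherianAlgebra R] (X : Type u) [AddCommGroup X] [Module R X]
    [Module.Finite R X] : Module.Finite S (c.corner X) := by
  obtain ⟨R₀, _, _, _, _⟩ := h.exists_finite_algebra
  let _ : Module R₀ X := Module.compHom X (algebraMap R₀ R)
  have : IsScalarTower R₀ R X := ⟨fun a r x => by
    rw [Algebra.smul_def, mul_smul]; rfl⟩
  have : Module.Finite R₀ X := Module.Finite.trans R X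
  let K : Submodule R₀ X :=
    { c.corner X with
      smul_mem' := fun a x hx => by
        change c.e • algebraMap R₀ R a • x = algebraMap R₀ R a • x
        rw [smul_smul, ← Algebra.commutes, mul_smul, c.mem_corner.1 hx] }
  let _ : Module R₀ (c.corner X) := K.module
  have : Module.Finite R₀ (c.corner X) := inferInstanceAs (Module.Finite R₀ K)
  let _ : SMul R₀ S := ⟨fun a s => c.proj (algebraMap R₀ R a) * s⟩
  have : IsScalarTower R₀ S (c.corner X) := ⟨fun a s x => Subtype.ext (by
    change c.incl (c.proj (algebraMap R₀ R a) * s) • (x : X) =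
      algebraMap R₀ R a • c.incl s • (x : X)
    rw [map_mul, ← e_mul_mul_e, smul_smul, ← Algebra.commutes, mul_assoc, mul_assoc, c.e_mul_incl,
      c.e_mul_incl])⟩
  exact Module.Finite.of_restrictScalars_finite R₀ S (c.corner X)

lemma exact_cornerMap {X Y Z : Type u} [AddCommGroup X] [Module R X] [AddCommGroup Y] [Module R Y]
    [AddCommGroup Z] [Module R Z] (f : X →ₗ[R] Y) (g : Y →ₗ[R] Z) (h : Function.Exact f g) :
    Function.Exact (c.cornerMap f) (c.cornerMap g) := by
  intro y
  rw [← Subtype.val_inj, coe_cornerMap]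
  refine (h y).trans ⟨?_, ?_⟩
  · rintro ⟨x, hx⟩
    -- A preimage of an element fixed by `e` stays a preimage after multiplication by `e`.
    exact ⟨⟨c.e • x, c.e_smul_mem x⟩, Subtype.ext (by
      rw [coe_cornerMap, map_smul, hx, e_smul_coe])⟩
  · rintro ⟨x, rfl⟩
    exact ⟨x, rfl⟩

/-- The corner functor on finitely generated modules. -/
def cornerFunctor [IsNoetherianAlgebra R] : FGModuleCat.{u} R ⥤ FGModuleCat.{u} S where
  obj X := ⟨ModuleCat.of S (c.corner X), c.finite_corner X⟩
  map f := ObjectProperty.homMk (ModuleCat.ofHom (c.cornerMap f.hom.hom))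

section

variable [IsNoetherianAlgebra R]

instance : c.cornerFunctor.Additive where

variable [IsNoetherianRing R] [IsNoetherianRing S]

instance : PreservesFiniteLimits c.cornerFunctor :=
  (FGModuleCat.exact_of_map_shortExact c.cornerFunctor fun _ h => c.exact_cornerMap _ _ h).1

instance : PreservesFiniteColimits c.cornerFunctor :=
  (FGModuleCat.exact_of_map_shortExact c.cornerFunctor fun _ h => c.exact_cornerMap _ _ h).2

/-- The corner of an inflated module. -/
def cornerInflationEquiv (X : FGModuleCat.{u} S) : c.corner (c.inflation.obj X) ≃ₗ[S] X where
  toFun x := x.1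
  map_add' _ _ := rfl
  map_smul' s x := by
    exact congrArg (fun a : S => a • (show X from x.1)) (c.proj_incl s)
  invFun x := ⟨x, by
    exact (congrArg (fun a : S => a • x) c.proj_e).trans (one_smul S x)⟩

/-- Inflation is a section of the corner functor. -/
def inflationCompCorner : c.inflation ⋙ c.cornerFunctor ≅ 𝟭 _ :=
  NatIso.ofComponents (fun X =>
    { hom := ObjectProperty.homMk (ModuleCat.ofHom (X := c.corner (c.inflation.obj X)) (Y := X.obj)
        (c.cornerInflationEquiv X).toLinearMap)
      inv := ObjectProperty.homMk (ModuleCat.ofHom (Y := c.corner (c.inflation.obj X)) (X := X.obj)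
        (c.cornerInflationEquiv X).symm.toLinearMap)
      hom_inv_id := rfl
      inv_hom_id := rfl }) fun _ => rfl

instance : c.cornerFunctor.EssSurj where
  mem_essImage X := ⟨_, ⟨c.inflationCompCorner.app X⟩⟩

end

/-! ### Projectivity of corners -/

/-- The corner of a free module is a direct sum of copies of `e R`. A splitting of the canonical map
from the free module on `P` restricts to corners. -/
lemma projective_corner (h : Module.Projective S (c.corner R)) (P : Type u) [AddCommGroup P]
    [Module R P] [hP : Module.Projective R P] : Module.Projective S (c.corner P) := by
  obtain ⟨s, hs⟩ := hP.out
  let f : R →+ c.corner R :=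
    { toFun := fun r => ⟨c.e • r, c.e_smul_mem r⟩
      map_zero' := Subtype.ext (smul_zero _)
      map_add' := fun _ _ => Subtype.ext (smul_add _ _ _) }
  let i : c.corner P →ₗ[S] (P →₀ c.corner R) :=
    { toFun := fun x => (s x).mapRange f (map_zero f)
      map_add' := fun x y => by
        ext p
        simp
      map_smul' := fun a x => by
        ext p
        simp [f, ← mul_assoc] }
  let t : (P →₀ c.corner R) →ₗ[S] c.corner P :=
    Finsupp.lsum ℕ fun p => c.cornerMap (LinearMap.toSpanSingleton R P p)
  have key (g : P →₀ R) : (t (g.mapRange f (map_zero f)) : P) =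
      c.e • Finsupp.linearCombination R id g := by
    induction g using Finsupp.induction_linear with
    | zero => simp
    | add g₁ g₂ h₁ h₂ =>
      rw [Finsupp.mapRange_add (map_add f), map_add, AddSubgroup.coe_add, h₁, h₂, map_add, smul_add]
    | single p r => simp [t, f, smul_smul]
  have : Module.Projective S (P →₀ c.corner R) := by
    classical exact Module.Projective.of_equiv (finsuppLequivDFinsupp S).symm
  refine Module.Projective.of_split i t (LinearMap.ext fun x => Subtype.ext ((key _).trans ?_))
  rw [hs]
  exact c.e_smul_coe x

/-- Corner functors preserve projective objects if the corner of the ring is projective. -/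
lemma preservesProjectiveObjects [IsNoetherianAlgebra R] [IsNoetherianRing R] [IsNoetherianRing S]
    (h : Module.Projective S (c.corner R)) : c.cornerFunctor.PreservesProjectiveObjects where
  projective_obj {P} hP := by
    have := (FGModuleCat.projective_iff_module P).1 hP
    exact FGModuleCat.projective_of_module _ (c.projective_corner h P)

end CornerProjection

/-! ### Complementary corners and the filtration they induce -/

/-- Two corner projections of a ring whose idempotents are complementary. -/
structure CornerProjection.IsCompl {R S₁ S₂ : Type u} [Ring R] [Ring S₁] [Ring S₂]
    (c₁ : CornerProjection R S₁) (c₂ : CornerProjection R S₂) : Prop where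
  add_eq_one : c₁.e + c₂.e = 1

namespace CornerProjection.IsCompl

variable {R S₁ S₂ : Type u} [Ring R] [Ring S₁] [Ring S₂] {c₁ : CornerProjection R S₁}
  {c₂ : CornerProjection R S₂} (h : c₁.IsCompl c₂)

include h

lemma symm : c₂.IsCompl c₁ := ⟨by rw [add_comm, h.add_eq_one]⟩

lemma proj_right : c₁.proj c₂.e = 0 := by
  have := congrArg c₁.proj h.add_eq_one
  rwa [map_add, proj_e, map_one, add_eq_left] at this

lemma proj_left : c₂.proj c₁.e = 0 := h.symm.proj_right

/-- Elements in the kernels of both projections multiply to zero. -/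
lemma mul_eq_zero {r s : R} (hr₁ : c₁.proj r = 0) (hr₂ : c₂.proj r = 0) (hs₁ : c₁.proj s = 0)
    (hs₂ : c₂.proj s = 0) : r * s = 0 := by
  -- Inserting `1 = e₁ + e₂` between `r` and `s` and after `s`, the terms containing `e₁ r e₁` or
  -- `e₂ s e₂` vanish. The remaining term `e₁ r e₂ s e₁` equals `e₁ r s e₁ - e₁ r e₁ s e₁`, where
  -- `e₁ (r s) e₁` comes from the projection of `r s`, which is zero.
  have key {S₁ S₂ : Type u} [Ring S₁] [Ring S₂] {c₁ : CornerProjection R S₁}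
      {c₂ : CornerProjection R S₂} (h : c₁.IsCompl c₂) (hr₁ : c₁.proj r = 0)
      (hs₂ : c₂.proj s = 0) : c₁.e * (r * s) = 0 := by
    calc c₁.e * (r * s) = c₁.e * r * (c₁.e + c₂.e) * s * (c₁.e + c₂.e) := by
          rw [h.add_eq_one, mul_one, mul_one, mul_assoc]
      _ = c₁.e * r * c₁.e * s * (c₁.e + c₂.e) + c₁.e * r * (c₂.e * s * c₂.e) +
          c₁.e * r * (c₁.e + c₂.e) * s * c₁.e - c₁.e * r * c₁.e * s * c₁.e := by noncomm_ring
      _ = 0 := by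
          rw [e_mul_mul_e, e_mul_mul_e, h.add_eq_one, hr₁, hs₂, mul_one,
            mul_one, mul_assoc c₁.e r s, e_mul_mul_e c₁ (r * s), map_mul, hr₁]
          simp
  rw [← one_mul (r * s), ← h.add_eq_one, add_mul, key h hr₁ hs₂, key h.symm hr₂ hs₁, add_zero]

variable (c₁ c₂) in
omit h in
/-- The elements killed by the kernel of both projections. -/
def annihilated (X : Type u) [AddCommGroup X] [Module R X] : Submodule R X where
  carrier := {x | ∀ r : R, c₁.proj r = 0 → c₂.proj r = 0 → r • x = 0}
  zero_mem' _ _ _ := smul_zero _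
  add_mem' {x y} hx hy r h₁ h₂ := by rw [smul_add, hx r h₁ h₂, hy r h₁ h₂, add_zero]
  smul_mem' s x hx r h₁ h₂ := by
    rw [smul_smul]
    exact hx _ (by rw [map_mul, h₁, zero_mul]) (by rw [map_mul, h₂, zero_mul])

variable (c₁ c₂) in
omit h in
/-- The functor sending a module to the submodule of elements killed by the kernel of both
projections. -/
def subFunctor [IsNoetherianRing R] : FGModuleCat.{u} R ⥤ FGModuleCat.{u} R where
  obj X := FGModuleCat.of R (annihilated c₁ c₂ X)
  map f := ObjectProperty.homMk (ModuleCat.ofHom (f.hom.hom.restrict fun x hx r h₁ h₂ => by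
    rw [← map_smul, hx r h₁ h₂, map_zero]))

variable (c₁ c₂) in
omit h in
/-- The functor sending a module to the quotient by the elements killed by the kernel of both
projections. -/
def quotFunctor [IsNoetherianRing R] : FGModuleCat.{u} R ⥤ FGModuleCat.{u} R where
  obj X := FGModuleCat.of R (X ⧸ annihilated c₁ c₂ X)
  map {X Y} f := ObjectProperty.homMk (ModuleCat.ofHom
    ((annihilated c₁ c₂ X).mapQ (annihilated c₁ c₂ Y) f.hom.hom fun x hx r h₁ h₂ => by
      rw [← map_smul, hx r h₁ h₂, map_zero]))
  map_id X := FGModuleCat.hom_ext (Submodule.linearMap_qext _ rfl)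
  map_comp f g := FGModuleCat.hom_ext (Submodule.linearMap_qext _ rfl)

instance [IsNoetherianRing R] : (subFunctor c₁ c₂).Additive where

instance [IsNoetherianRing R] : (quotFunctor c₁ c₂).Additive where
  map_add := FGModuleCat.hom_ext (Submodule.linearMap_qext _ rfl)

omit h in
lemma smul_subFunctor_obj [IsNoetherianRing R] (X : FGModuleCat.{u} R) (r : R)
    (h₁ : c₁.proj r = 0) (h₂ : c₂.proj r = 0) (x : (subFunctor c₁ c₂).obj X) : r • x = 0 :=
  Subtype.ext (x.2 r h₁ h₂)

/-- The common kernel has square zero, so it maps every module into the submodule that it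
annihilates. -/
lemma smul_quotFunctor_obj [IsNoetherianRing R] (X : FGModuleCat.{u} R) (r : R)
    (h₁ : c₁.proj r = 0) (h₂ : c₂.proj r = 0) (x : (quotFunctor c₁ c₂).obj X) : r • x = 0 := by
  obtain ⟨x, rfl⟩ := Submodule.Quotient.mk_surjective _ x
  refine (Submodule.Quotient.mk_eq_zero (annihilated c₁ c₂ X) (x := r • x)).2 ?_
  intro s hs₁ hs₂
  rw [smul_smul, h.mul_eq_zero hs₁ hs₂ h₁ h₂, zero_smul]

section

variable (F : FGModuleCat.{u} R ⥤ FGModuleCat.{u} R)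
  (hF : ∀ X r, c₁.proj r = 0 → c₂.proj r = 0 → ∀ x : F.obj X, r • x = 0)

include hF in
-- Commutators with `e₁` lie in both kernels, so `e₁` acts centrally on modules killed by the common
-- kernel. This is why their corners are direct summands over `R`.
lemma e_smul_smul (X : FGModuleCat.{u} R) (r : R) (x : F.obj X) :
    c₁.e • r • x = r • c₁.e • x := by
  rw [← sub_eq_zero, smul_smul, smul_smul, ← sub_smul]
  refine hF X _ ?_ ?_ x <;> simp [h.proj_left]

variable [IsNoetherianAlgebra R]

/-- The projection onto the first part of a module killed by the kernel of both projections. -/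
def toInflation : F ⟶ (F ⋙ c₁.cornerFunctor) ⋙ c₁.inflation where
  app X := ObjectProperty.homMk (ModuleCat.ofHom (X := F.obj X)
    (Y := c₁.inflation.obj (c₁.cornerFunctor.obj (F.obj X)))
    { toFun := fun x => (⟨c₁.e • x, c₁.e_smul_mem x⟩ : c₁.corner (F.obj X))
      map_add' := fun x y => Subtype.ext (smul_add _ _ _)
      map_smul' := fun r x => Subtype.ext (by
        change c₁.e • r • x = c₁.incl (c₁.proj r) • c₁.e • x
        rw [← e_mul_mul_e, smul_smul _ c₁.e x, mul_assoc, e_mul_e, ← smul_smul, ← smul_smul,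
          h.e_smul_smul F hF, h.e_smul_smul F hF, smul_smul c₁.e c₁.e, e_mul_e]) })
  naturality X Y f := by
    ext x
    exact Subtype.ext (map_smul (F.map f).hom.hom c₁.e x).symm

/-- The inclusion of the first part of a module killed by the kernel of both projections. -/
def ofInflation : (F ⋙ c₁.cornerFunctor) ⋙ c₁.inflation ⟶ F where
  app X := ObjectProperty.homMk (ModuleCat.ofHom (Y := F.obj X)
    (X := c₁.inflation.obj (c₁.cornerFunctor.obj (F.obj X)))
    { toFun := fun x => (show c₁.corner (F.obj X) from x).1
      map_add' := fun x y => rfl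
      map_smul' := fun r x => by
        obtain ⟨x, hx⟩ : c₁.corner (F.obj X) := x
        change c₁.incl (c₁.proj r) • x = r • x
        rw [mem_corner] at hx
        rw [← e_mul_mul_e, ← smul_smul, ← smul_smul, hx, h.e_smul_smul F hF, hx] })
  naturality X Y f := rfl

end

/-- Functorial decomposition of modules on which the kernel of both projections acts as zero. -/
def sumDecomposition [IsNoetherianAlgebra R] [IsNoetherianRing R]
    [IsNoetherianRing S₁] [IsNoetherianRing S₂]
    (F : FGModuleCat.{u} R ⥤ FGModuleCat.{u} R) [F.Additive]
    (hF : ∀ X r, c₁.proj r = 0 → c₂.proj r = 0 → ∀ x : F.obj X, r • x = 0) :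
    SumDecomposition F c₁.inflation c₂.inflation where
  left := F ⋙ c₁.cornerFunctor
  right := F ⋙ c₂.cornerFunctor
  left_additive := inferInstance
  right_additive := inferInstance
  fst := h.toInflation F hF
  inl := h.ofInflation F hF
  snd := h.symm.toInflation F fun X r h₂ h₁ => hF X r h₁ h₂
  inr := h.symm.ofInflation F fun X r h₂ h₁ => hF X r h₁ h₂
  inl_fst X := by
    ext x
    exact Subtype.ext (c₁.e_smul_coe _)
  inr_snd X := by
    ext x
    exact Subtype.ext (c₂.e_smul_coe _)
  total X := by
    ext x
    change c₁.e • x + c₂.e • x = x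
    rw [← add_smul, h.add_eq_one, one_smul]

/-- Every module has a functorial filtration with inflated subquotients. -/
def twoStepFiltration [IsNoetherianAlgebra R] [IsNoetherianRing R]
    [IsNoetherianRing S₁] [IsNoetherianRing S₂] :
    TwoStepFiltration c₁.inflation c₂.inflation where
  sub := subFunctor c₁ c₂
  quot := quotFunctor c₁ c₂
  sub_additive := inferInstance
  quot_additive := inferInstance
  ι := { app := fun X => ObjectProperty.homMk (ModuleCat.ofHom (annihilated c₁ c₂ X).subtype) }
  π := { app := fun X => ObjectProperty.homMk (ModuleCat.ofHom (annihilated c₁ c₂ X).mkQ) }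
  w X := FGModuleCat.hom_ext (LinearMap.ext fun x => (Submodule.Quotient.mk_eq_zero _).2 x.2)
  shortExact X := FGModuleCat.shortExact_of_function _ _ _ (Submodule.subtype_injective _)
    (LinearMap.exact_subtype_mkQ _) (Submodule.mkQ_surjective _)
  subDecomposition := h.sumDecomposition _ smul_subFunctor_obj
  quotDecomposition := h.sumDecomposition _ h.smul_quotFunctor_obj

end CornerProjection.IsCompl

/-! ### Off-diagonal bimodules and syzygies of inflated projectives -/

namespace CornerProjection

variable {R S₁ S₂ : Type u} [Ring R] [Ring S₁] [Ring S₂]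

/-- A left `S₂`-module `N` identified with the off-diagonal part `e₂ R e₁` of `R`. -/
structure OffDiagonal (c₁ : CornerProjection R S₁) (c₂ : CornerProjection R S₂)
    (N : Type u) [AddCommGroup N] [Module S₂ N] where
  isCompl : c₁.IsCompl c₂
  /-- the inclusion -/
  toFun : N →+ R
  injective : Function.Injective toFun
  exists_eq (r : R) (h₁ : r * c₁.e = r) (h₂ : c₁.proj r = 0) : ∃ n, toFun n = r
  mul_e (n : N) : toFun n * c₁.e = toFun n
  proj_eq_zero (n : N) : c₁.proj (toFun n) = 0
  map_smul (s : S₂) (n : N) : toFun (s • n) = c₂.incl s * toFun n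

namespace OffDiagonal

variable {c₁ : CornerProjection R S₁} {c₂ : CornerProjection R S₂} {N : Type u} [AddCommGroup N]
  [Module S₂ N] (j : OffDiagonal c₁ c₂ N)

lemma e_mul (n : N) : c₂.e * j.toFun n = j.toFun n := by
  rw [e, ← j.map_smul, one_smul]

/-- The off-diagonal part is a left ideal fixed by `e₂` on the left, so `r` acts on it through `e₂ r
e₂`. Hence the inclusion is `R`-linear on the inflation of `N`. -/
lemma mul_toFun (r : R) (n : N) : r * j.toFun n = j.toFun (c₂.proj r • n) := by
  obtain ⟨m, hm⟩ := j.exists_eq (r * j.toFun n) (by rw [mul_assoc, j.mul_e])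
    (by rw [map_mul, j.proj_eq_zero, mul_zero])
  rw [j.map_smul, ← e_mul_mul_e, mul_assoc, mul_assoc, j.e_mul, ← hm, j.e_mul]

/-- The map to the corner `e₂ R` from the sum of `e₂ R e₁` and `e₂ R e₂`. -/
def toCorner : (N × S₂) →ₗ[S₂] c₂.corner R where
  toFun x := ⟨j.toFun x.1 + c₂.incl x.2, by
    rw [mem_corner, smul_eq_mul, mul_add, j.e_mul, e_mul_incl]⟩
  map_add' x y := Subtype.ext (by
    simp only [Prod.fst_add, Prod.snd_add, map_add, AddSubgroup.coe_add]
    abel)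
  map_smul' s x := Subtype.ext (by
    simp [j.map_smul, mul_add])

/-- The splitting of the corner `e₂ R` into `e₂ R e₁` and `e₂ R e₂`. -/
def cornerEquiv : (N × S₂) ≃ₗ[S₂] c₂.corner R :=
  LinearEquiv.ofBijective j.toCorner (by
    constructor
    · rw [injective_iff_map_eq_zero]
      rintro ⟨n, s⟩ h
      have h' : j.toFun n + c₂.incl s = 0 := congrArg Subtype.val h
      have hs : s = 0 := by
        have := congrArg c₂.proj h'
        rwa [← j.mul_e, map_add, map_mul, j.isCompl.proj_left, mul_zero, zero_add, proj_incl,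
          map_zero] at this
      subst hs
      rw [map_zero, add_zero] at h'
      rw [j.injective (h'.trans (map_zero _).symm)]
      rfl
    · rintro ⟨x, hx⟩
      rw [mem_corner, smul_eq_mul] at hx
      obtain ⟨n, hn⟩ := j.exists_eq (x * c₁.e) (by rw [mul_assoc, e_mul_e])
        (by rw [map_mul, ← hx, map_mul, j.isCompl.proj_right]; simp)
      refine ⟨(n, c₂.proj x), Subtype.ext ?_⟩
      change j.toFun n + c₂.incl (c₂.proj x) = x
      rw [hn, ← e_mul_mul_e, hx, ← mul_add, j.isCompl.add_eq_one, mul_one])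

include j in
lemma projective_corner (h : Module.Projective S₂ N) : Module.Projective S₂ (c₂.corner R) :=
  Module.Projective.of_equiv j.cornerEquiv

include j in
lemma finite [IsNoetherianAlgebra R] : Module.Finite S₂ N := by
  have := c₂.finite_corner R
  have : Module.Finite S₂ (N × S₂) := Module.Finite.equiv j.cornerEquiv.symm
  exact Module.Finite.of_surjective (LinearMap.fst S₂ N S₂) Prod.fst_surjective

variable (c₁) in
omit j in
/-- The projective module `R e₁`. -/
def column : Submodule R R where
  carrier := {r | r * c₁.e = r}
  zero_mem' := zero_mul _
  add_mem' {x y} hx hy := by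
    rw [Set.mem_ofPred_eq] at *
    rw [add_mul, hx, hy]
  smul_mem' s x hx := by
    rw [Set.mem_ofPred_eq] at *
    rw [smul_eq_mul, mul_assoc, hx]

variable (c₁) in
omit j in
lemma projective_column : Module.Projective R (column c₁) :=
  Module.Projective.of_split (column c₁).subtype
    ((LinearMap.toSpanSingleton R R c₁.e).codRestrict (column c₁) fun r => by
      change r * c₁.e * c₁.e = r * c₁.e
      rw [mul_assoc, e_mul_e])
    (LinearMap.ext fun x => Subtype.ext x.2)

omit j in
/-- The inflation of `N` is projective when it is projective and linear functionals on `N` take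
values in elements killed by `e₁ R e₂`. -/
lemma projective_inflation (h : c₁.IsCompl c₂) [IsNoetherianRing R] [IsNoetherianRing S₂]
    [Module.Finite S₂ N]
    [hN : Module.Projective S₂ N]
    (hφ : ∀ (φ : N →ₗ[S₂] S₂) (n : N) (r : R), c₁.e * r * c₂.incl (φ n) = 0) :
    Projective (c₂.inflation.obj (FGModuleCat.of S₂ N)) := by
  rw [FGModuleCat.projective_iff_module]
  obtain ⟨s, hs⟩ := hN.out
  let _ : Module R N := Module.compHom N c₂.proj
  let σ : N →ₗ[R] (N →₀ R) :=
    { toFun := fun n => (s n).mapRange c₂.incl (map_zero _)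
      map_add' := fun x y => by
        ext p
        simp
      map_smul' := fun r n => by
        ext p
        -- Each dual basis coordinate, followed by the inclusion of `S₂`, is `R`-linear: in `r = e₁
        -- r + e₂ r` the first part acts as zero by `hφ`, and the second acts as the projection of
        -- `r`.
        have := hφ (Finsupp.lapply p ∘ₗ s) n r
        have h₁ : s (r • n) = c₂.proj r • s n := s.map_smul _ _
        change c₁.e * r * c₂.incl (s n p) = 0 at this
        simp only [h₁, Finsupp.mapRange_apply, Finsupp.smul_apply, smul_eq_mul, map_mul,
          RingHom.id_apply]
        calc c₂.incl (c₂.proj r) * c₂.incl (s n p)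
          _ = c₁.e * r * c₂.incl (s n p) + c₂.e * r * c₂.incl (s n p) := by
              rw [this, ← e_mul_mul_e, mul_assoc, e_mul_incl, zero_add]
          _ = r * c₂.incl (s n p) := by rw [← add_mul, ← add_mul, h.add_eq_one, one_mul] }
  have key (g : N →₀ S₂) : Finsupp.linearCombination R id (g.mapRange c₂.incl (map_zero _)) =
      Finsupp.linearCombination S₂ id g := by
    induction g using Finsupp.induction_linear with
    | zero => simp
    | add g₁ g₂ h₁ h₂ => rw [Finsupp.mapRange_add (map_add _), map_add, h₁, h₂, map_add]
    | single p a =>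
      rw [Finsupp.mapRange_single, Finsupp.linearCombination_single,
        Finsupp.linearCombination_single]
      exact congrArg (fun a : S₂ => a • p) (c₂.proj_incl a)
  exact (⟨σ, fun n => (key _).trans (hs n)⟩ : Module.Projective R N)

include j in
-- The sequence `0 → N → R e₁ → S₁ → 0` has projective `R e₁` and, by `projective_inflation`,
-- projective left term. So the inflation of `S₁`, and then of every finitely generated projective,
-- has projective dimension at most one.
lemma exists_isSyzygy [IsNoetherianAlgebra R] [IsNoetherianRing R] [IsNoetherianRing S₁]
    [IsNoetherianRing S₂] [hN : Module.Projective S₂ N]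
    (hφ : ∀ (φ : N →ₗ[S₂] S₂) (n : N) (r : R), c₁.e * r * c₂.incl (φ n) = 0)
    (P : FGModuleCat.{u} S₁) (hP : Projective P) :
    ∃ Q, Projective Q ∧ IsSyzygy 1 (c₁.inflation.obj P) Q := by
  have := j.finite
  let f : c₂.inflation.obj (FGModuleCat.of S₂ N) ⟶ FGModuleCat.of R (column c₁) :=
    ObjectProperty.homMk (ModuleCat.ofHom (X := c₂.inflation.obj (FGModuleCat.of S₂ N))
      { toFun := fun n => ⟨j.toFun n, j.mul_e n⟩
        map_add' := fun _ _ => Subtype.ext (map_add j.toFun _ _)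
        map_smul' := fun r n => Subtype.ext (j.mul_toFun r n).symm })
  let g : FGModuleCat.of R (column c₁) ⟶ c₁.inflation.obj (FGModuleCat.of S₁ S₁) :=
    ObjectProperty.homMk (ModuleCat.ofHom (Y := c₁.inflation.obj (FGModuleCat.of S₁ S₁))
      { toFun := fun r => c₁.proj r.1
        map_add' := fun _ _ => map_add c₁.proj _ _
        map_smul' := fun r n => map_mul c₁.proj _ _ })
  have H : (ShortComplex.mk f g (by ext n; exact j.proj_eq_zero n)).ShortExact := by
    refine FGModuleCat.shortExact_of_function _ _ _ ?_ ?_ ?_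
    · exact fun x y h => j.injective congr(Subtype.val $h)
    · intro r
      refine ⟨fun h => ?_, ?_⟩
      · obtain ⟨n, hn⟩ := j.exists_eq r.1 r.2 h
        exact ⟨n, Subtype.ext hn⟩
      · rintro ⟨n, rfl⟩
        exact j.proj_eq_zero n
    · exact fun s => ⟨⟨c₁.incl s, c₁.incl_mul_e s⟩, c₁.proj_incl s⟩
  have hf := projective_inflation j.isCompl hφ
  have hc := FGModuleCat.projective_of_module (FGModuleCat.of R (column c₁)) (projective_column c₁)
  -- Projective dimension less than `2` passes to sums and summands without tracking resolutions; it
  -- makes the kernel of any projective presentation projective.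
  have key : addClosure (.singleton (FGModuleCat.of S₁ S₁)) ≤
      fun X => HasProjectiveDimensionLT (c₁.inflation.obj X) 2 := by
    refine addClosure_le ?_ ?_ ?_ ?_
    · intro X hX
      have := (c₁.inflation.map_isZero hX).hasProjectiveDimensionLT_zero
      exact hasProjectiveDimensionLT_of_ge _ 0 2 (by simp)
    · intro X Y hX hY
      have : HasProjectiveDimensionLT (c₁.inflation.obj X) 2 := hX
      have : HasProjectiveDimensionLT (c₁.inflation.obj Y) 2 := hY
      have := preservesBinaryBiproducts_of_preservesBiproducts c₁.inflation
      exact hasProjectiveDimensionLT_of_iso (c₁.inflation.mapBiprod X Y).symm 2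
    · intro X Y r hY
      have : HasProjectiveDimensionLT (c₁.inflation.obj Y) 2 := hY
      exact (r.map c₁.inflation).hasProjectiveDimensionLT 2
    · intro X hX
      obtain rfl := (ObjectProperty.singleton_iff _ _).1 hX
      exact H.hasProjectiveDimensionLT_X₃ 1 (projective_iff_hasProjectiveDimensionLT_one.1 hf)
        (hasProjectiveDimensionLT_of_ge _ 1 2 (by simp))
  have hP' := key P ((FGModuleCat.isFiniteProjectiveGenerator S₁).addClosure_of_projective P)
  obtain ⟨Q, q, hQ, -, _⟩ := FGModuleCat.isFiniteProjectiveGenerator R (c₁.inflation.obj P)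
  refine ⟨kernel q, ?_, isSyzygy_one_iff.2 ⟨Q, _, q, _, hQ, shortExact_kernel q⟩⟩
  rw [projective_iff_hasProjectiveDimensionLT_one]
  exact (shortExact_kernel q).hasProjectiveDimensionLT_X₁ 1
    (projective_iff_hasProjectiveDimensionLT_one.1 hQ) hP'

end OffDiagonal

end CornerProjection

/-- The map `x ⊗ y ↦ φ(x) y` is balanced, so it factors through the zero group. -/
lemma BalancedTensor.unop_smul_eq_zero {R X Y : Type u} [Ring R] [AddCommGroup X] [Module Rᵐᵒᵖ X]
    [AddCommGroup Y] [Module R Y] (h : Subsingleton (BalancedTensor R X Y))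
    (φ : X →ₗ[Rᵐᵒᵖ] Rᵐᵒᵖ) (x : X) (y : Y) : (φ x).unop • y = 0 := by
  let f : X →+ Y →+ Y :=
    (smulAddHom R Y).comp ((opAddEquiv (α := R)).symm.toAddMonoidHom.comp φ.toAddMonoidHom)
  let g : BalancedTensor R X Y →+ Y :=
    QuotientAddGroup.lift _ (TensorProduct.liftAddHom f fun n x y => by simp) (by
      refine (AddSubgroup.closure_le _).2 ?_
      rintro _ ⟨x, r, y, rfl⟩
      change _ = _
      simp [f, mul_smul])
  have h₀ : (QuotientAddGroup.mk (x ⊗ₜ[ℤ] y) : BalancedTensor R X Y) = 0 := Subsingleton.elim _ _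
  exact (congrArg g h₀).trans (map_zero g)

lemma IsNoetherianAlgebra.op {Λ : Type u} [Ring Λ] (h : IsNoetherianAlgebra Λ) :
    IsNoetherianAlgebra Λᵐᵒᵖ := by
  obtain ⟨R, _, _, _, _⟩ := h.exists_finite_algebra
  exact ⟨R, inferInstance, inferInstance, inferInstance,
    Module.Finite.equiv (MulOpposite.opLinearEquiv R (M := Λ))⟩

/-! ### The corners and off-diagonal parts of the Morita context ring -/

namespace MoritaContextRing

variable (A B M N : Type u) [Ring A] [Ring B] [AddCommGroup M] [AddCommGroup N]
  [Module A N] [Module Bᵐᵒᵖ N] [SMulCommClass A Bᵐᵒᵖ N]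
  [Module B M] [Module Aᵐᵒᵖ M] [SMulCommClass B Aᵐᵒᵖ M]

/-- The inclusion of `A` into the Morita context ring. -/
def inclLeft : Aᵐᵒᵖ →ₙ+* (MoritaContextRing A B M N)ᵐᵒᵖ where
  toFun a := op ⟨a.unop, 0, 0, 0⟩
  map_zero' := rfl
  map_add' _ _ := unop_injective (by ext <;> simp)
  map_mul' _ _ := unop_injective (by ext <;> simp)

lemma inclLeft_apply (a : Aᵐᵒᵖ) : inclLeft A B M N a = op ⟨a.unop, 0, 0, 0⟩ := rfl

/-- The corner `A` of the Morita context ring. -/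
def cornerLeft : CornerProjection (MoritaContextRing A B M N)ᵐᵒᵖ Aᵐᵒᵖ where
  proj := (projLeft A B M N).op
  incl := inclLeft A B M N
  proj_incl _ := rfl
  incl_one_mul_mul r := unop_injective (by ext <;> simp [projLeft, inclLeft_apply])

/-- The inclusion of `B` into the Morita context ring. -/
def inclRight : Bᵐᵒᵖ →ₙ+* (MoritaContextRing A B M N)ᵐᵒᵖ where
  toFun b := op ⟨0, 0, 0, b.unop⟩
  map_zero' := rfl
  map_add' _ _ := unop_injective (by ext <;> simp)
  map_mul' _ _ := unop_injective (by ext <;> simp)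

lemma inclRight_apply (b : Bᵐᵒᵖ) : inclRight A B M N b = op ⟨0, 0, 0, b.unop⟩ := rfl

/-- The corner `B` of the Morita context ring. -/
def cornerRight : CornerProjection (MoritaContextRing A B M N)ᵐᵒᵖ Bᵐᵒᵖ where
  proj := (projRight A B M N).op
  incl := inclRight A B M N
  proj_incl _ := rfl
  incl_one_mul_mul r := unop_injective (by ext <;> simp [projRight, inclRight_apply])

lemma isCompl_corner : (cornerLeft A B M N).IsCompl (cornerRight A B M N) where
  add_eq_one := unop_injective (by
    ext <;> simp [cornerLeft, cornerRight, CornerProjection.e, inclLeft_apply, inclRight_apply])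

/-- The upper right entries of the Morita context ring. -/
def offDiagonalLeft : (cornerLeft A B M N).OffDiagonal (cornerRight A B M N) N where
  isCompl := isCompl_corner A B M N
  toFun :=
    { toFun := fun n => op ⟨0, n, 0, 0⟩
      map_zero' := rfl
      map_add' := fun _ _ => unop_injective (by ext <;> simp) }
  injective x y h := congrArg (fun z => z.unop.n) h
  exists_eq r h₁ h₂ := by
    have h₂ : r.unop.a = 0 := congrArg unop h₂
    refine ⟨r.unop.n, unop_injective ?_⟩
    rw [← h₁]
    ext <;> simp [cornerLeft, CornerProjection.e, inclLeft_apply, h₂]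
  mul_e n := unop_injective (by ext <;> simp [cornerLeft, CornerProjection.e, inclLeft_apply])
  proj_eq_zero n := rfl
  map_smul s n := unop_injective (by ext <;> simp [cornerRight, inclRight_apply])

/-- The lower left entries of the Morita context ring. -/
def offDiagonalRight : (cornerRight A B M N).OffDiagonal (cornerLeft A B M N) M where
  isCompl := (isCompl_corner A B M N).symm
  toFun :=
    { toFun := fun m => op ⟨0, 0, m, 0⟩
      map_zero' := rfl
      map_add' := fun _ _ => unop_injective (by ext <;> simp) }
  injective x y h := congrArg (fun z => z.unop.m) h
  exists_eq r h₁ h₂ := by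
    have h₂ : r.unop.b = 0 := congrArg unop h₂
    refine ⟨r.unop.m, unop_injective ?_⟩
    rw [← h₁]
    ext <;> simp [cornerRight, CornerProjection.e, inclRight_apply, h₂]
  mul_e n := unop_injective (by ext <;> simp [cornerRight, CornerProjection.e, inclRight_apply])
  proj_eq_zero n := rfl
  map_smul s n := unop_injective (by ext <;> simp [cornerLeft, inclLeft_apply])

variable {A B M N}

/-- The only entry of the product that could survive is `φ(n)` times the `M`-entry of `r`, which `N
⊗_B M = 0` kills. -/
lemma cornerLeft_e_mul_mul (h : Subsingleton (BalancedTensor B N M)) (φ : N →ₗ[Bᵐᵒᵖ] Bᵐᵒᵖ) (n : N)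
    (r : (MoritaContextRing A B M N)ᵐᵒᵖ) :
    (cornerLeft A B M N).e * r * (cornerRight A B M N).incl (φ n) = 0 :=
  unop_injective (by
    ext <;> simp [cornerLeft, cornerRight, CornerProjection.e, inclLeft_apply, inclRight_apply,
      BalancedTensor.unop_smul_eq_zero h])

lemma cornerRight_e_mul_mul (h : Subsingleton (BalancedTensor A M N)) (φ : M →ₗ[Aᵐᵒᵖ] Aᵐᵒᵖ) (m : M)
    (r : (MoritaContextRing A B M N)ᵐᵒᵖ) :
    (cornerRight A B M N).e * r * (cornerLeft A B M N).incl (φ m) = 0 :=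
  unop_injective (by
    ext <;> simp [cornerLeft, cornerRight, CornerProjection.e, inclLeft_apply, inclRight_apply,
      BalancedTensor.unop_smul_eq_zero h])

end MoritaContextRing

end

theorem mainTheorem5 {A B M N : Type u} [Ring A] [Ring B] [AddCommGroup M] [AddCommGroup N]
    [Module A N] [Module Bᵐᵒᵖ N] [SMulCommClass A Bᵐᵒᵖ N]
    [Module B M] [Module Aᵐᵒᵖ M] [SMulCommClass B Aᵐᵒᵖ M]
    (hΛ : IsNoetherianAlgebra (MoritaContextRing A B M N))
    (hNM : Subsingleton (BalancedTensor B N M))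
    (hMN : Subsingleton (BalancedTensor A M N)) :
    haveI : IsNoetherianAlgebra A := MoritaContextRing.isNoetherianAlgebra_left hΛ
    haveI : IsNoetherianAlgebra B := MoritaContextRing.isNoetherianAlgebra_right hΛ
    (Module.Projective Bᵐᵒᵖ N → Module.Projective Aᵐᵒᵖ M →
      Module.Projective A N → Module.Projective B M →
        max (igusaTodorovDistance (FGRightMod A)) (igusaTodorovDistance (FGRightMod B)) ≤
            igusaTodorovDistance (FGRightMod (MoritaContextRing A B M N)) ∧
          igusaTodorovDistance (FGRightMod (MoritaContextRing A B M N)) ≤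
            2 * max (igusaTodorovDistance (FGRightMod A)) (igusaTodorovDistance (FGRightMod B))
              + 1) ∧
    (Module.Projective Bᵐᵒᵖ N → Module.Projective Aᵐᵒᵖ M →
        max (extensionDimension (FGRightMod A)) (extensionDimension (FGRightMod B)) ≤
            extensionDimension (FGRightMod (MoritaContextRing A B M N)) ∧
          extensionDimension (FGRightMod (MoritaContextRing A B M N)) ≤
            2 * max (extensionDimension (FGRightMod A)) (extensionDimension (FGRightMod B))
              + 1) ∧
    ((∀ i : ℕ, 1 ≤ i → IsZero (balancedTor B N i M)) →
      (∀ i : ℕ, 1 ≤ i → IsZero (balancedTor A M i N)) →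
      projectiveDimension (ModuleCat.of A N) < ⊤ →
      projectiveDimension (ModuleCat.of B M) < ⊤ →
        max (rouquierDimensionBoundedDerived (FGRightMod A))
              (rouquierDimensionBoundedDerived (FGRightMod B)) ≤
            rouquierDimensionBoundedDerived (FGRightMod (MoritaContextRing A B M N)) ∧
          rouquierDimensionBoundedDerived (FGRightMod (MoritaContextRing A B M N)) ≤
            2 * max (rouquierDimensionBoundedDerived (FGRightMod A))
              (rouquierDimensionBoundedDerived (FGRightMod B)) + 1) := by
  have : IsNoetherianAlgebra A := MoritaContextRing.isNoetherianAlgebra_left hΛ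
  have : IsNoetherianAlgebra B := MoritaContextRing.isNoetherianAlgebra_right hΛ
  have := hΛ.op
  let c₁ := MoritaContextRing.cornerLeft A B M N
  let c₂ := MoritaContextRing.cornerRight A B M N
  -- Right modules are left modules over `R = Λᵐᵒᵖ`, where products are reversed: `N = e₁ Λ e₂` is
  -- `e₂ R e₁`, so it belongs to the corner of `B`.
  let j₁ : c₁.OffDiagonal c₂ N := MoritaContextRing.offDiagonalLeft A B M N
  let j₂ : c₂.OffDiagonal c₁ M := MoritaContextRing.offDiagonalRight A B M N
  let t := (MoritaContextRing.isCompl_corner A B M N).twoStepFiltration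
  refine ⟨fun hN hM _ _ => ⟨?_, ?_⟩, fun _ _ => ⟨?_, ?_⟩, fun _ _ _ _ => ⟨?_, ?_⟩⟩
  -- As a right `A`-module the corner `Λ e₁` is `M ⊕ A`, and as a right `B`-module `Λ e₂` is `N ⊕
  -- B`, so both are projective.
  · have := c₁.preservesProjectiveObjects (j₂.projective_corner hM)
    have := c₂.preservesProjectiveObjects (j₁.projective_corner hN)
    exact max_le (igusaTodorovDistance_le_of_essSurj c₁.cornerFunctor)
      (igusaTodorovDistance_le_of_essSurj c₂.cornerFunctor)
  · exact igusaTodorovDistance_le_of_shortExact _ _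
      (FGModuleCat.isFiniteProjectiveGenerator _) (FGModuleCat.isFiniteProjectiveGenerator _)
      (FGModuleCat.isFiniteProjectiveGenerator _)
      (j₁.exists_isSyzygy (MoritaContextRing.cornerLeft_e_mul_mul hNM))
      (j₂.exists_isSyzygy (MoritaContextRing.cornerRight_e_mul_mul hMN))
      t.exists_shortExact
  · exact max_le (extensionDimension_le_of_essSurj c₁.cornerFunctor)
      (extensionDimension_le_of_essSurj c₂.cornerFunctor)
  · exact extensionDimension_le_of_shortExact _ _ t.exists_shortExact
  · let _ := HasDerivedCategory.standard (FGRightMod A)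
    let _ := HasDerivedCategory.standard (FGRightMod B)
    let _ := HasDerivedCategory.standard (FGRightMod (MoritaContextRing A B M N))
    have := mapBoundedDerivedCategory_essSurj _ _ c₁.inflationCompCorner
    have := mapBoundedDerivedCategory_essSurj _ _ c₂.inflationCompCorner
    exact max_le
      (rouquierDimension_le_of_essSurj c₁.cornerFunctor.mapBoundedDerivedCategory)
      (rouquierDimension_le_of_essSurj c₂.cornerFunctor.mapBoundedDerivedCategory)
  · let _ := HasDerivedCategory.standard (FGRightMod A)
    let _ := HasDerivedCategory.standard (FGRightMod B)
    let _ := HasDerivedCategory.standard (FGRightMod (MoritaContextRing A B M N))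
    exact rouquierDimension_bounded_le t
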